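/- **Theorem (Absolutization).** All systems are finite-dimensional with distinguished bases; a null system is one-dimensional. *Finite resources.* A finite dynamic resource $(\mathcal N:\omega)$ is a quantum operation (CPTP map) $\mathcal N:A'\to AB$ from Alice's input $A'=A^{\rm rel}A^{\rm abs}$ to a system shared by Alice ($A$) and Bob ($B$), with a test state $\omega$ on $A^{\rm rel}$. It is proper, written $\mathcal N$, if $A^{\rm rel}$ is null, and relative if $A^{\rm abs}$ is null. Tensor products are $(\mathcal N_1:\omega_1)\otimes(\mathcal N_2:\omega_2)=(\mathcal N_1\otimes\mathcal N_2:\omega_1\otimes\omega_2)$. For operations $\mathcal M,\mathcal N$ on $A'$ put $\|\mathcal M-\mathcal N\|_\omega=\sup_\xi\|(\mathrm{id}^R\otimes\mathcal M)\xi-(\mathrm{id}^R\otimes\mathcal N)\xi\|_1$, the supremum being over all reference systems $R$ and all states $\xi^{RA'}$ with $\operatorname{tr}_{RA^{\rm abs}}\xi=\omega$ (extensions of $\omega$), where $\|M\|_1=\operatorname{tr}\sqrt{M^\dagger M}$; this is the distance of $(\mathcal M:\omega)$ and $(\mathcal N:\omega)$. *Protocols.* A depth-$\ell$ resource is an unordered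 collection of $\ell$ finite resources $(\mathcal N_i:\omega_i)$, $\mathcal N_i:A_i'\to A_iB_i$; $\alpha^{\times k}$ is the collection of $k$ copies of $\alpha$, and $\mathbf S[\alpha]$ is the tensor product of the members of $\alpha$. A protocol $\mathbf P$ on it, creating $\mathbf P[\alpha]=(\mathcal P:\Omega)$ with $\mathcal P:A'\to AB$, is given by a permutation $\pi$ of $\{1,\dots,\ell\}$ and local operations as follows. Alice performs an operation $A'\to A_0A_0^{\rm aux}$; for $i=1,\dots,\ell$ she performs an isometry from what she then holds (the output left to her by the previous resource and her auxiliary system) to the input system of $\mathcal N_{\pi(i)}$ and a new auxiliary system, after which $\mathcal N_{\pi(i)}$ is applied; finally Alice performs an operation from what she holds to $A$ and Bob performs an operation from all his received outputs to $B$. The protocol is $\eta$-valid if, for every extension $\xi$ of $\Omega$ and every $i$, the state just before the application of $\mathcal N_{\pi(i)}$, restricted to the test system of that resource, is within trace norm $\eta$ of $\omega_{\pi(i)}$. *Asymptotic resources.* For sequences $\alpha=(\alpha_n)$, $\beta=(\beta_n)$ of finite resources, $\alpha\ge\beta$ means: for every $\delta>0$ there is an integer $k\ge1$ such that for every $\epsilon>0$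 there is $N$ such that for all $n\ge N$ there is an $\epsilon$-valid protocol $\mathbf P$ on $(\alpha_{\lfloor n/k\rfloor})^{\times k}$ with $\|\mathbf P[(\alpha_{\lfloor n/k\rfloor})^{\times k}]-\mathbf S[\beta_{\lfloor(1-\delta)n\rfloor}]\|\le\epsilon$ (negative indices being read as $0$). Resources are regarded as equal, $\alpha=\beta$, if $\alpha\ge\beta$ and $\beta\ge\alpha$. Let $\langle\mathcal N:\omega\rangle=((\mathcal N:\omega)^{\otimes n})_n$. Let $\tau=\frac12\mathbf 1$ be the maximally mixed qubit state; let $\mathrm{id}_2:A'\to B$ be the perfect qubit channel, $\Delta_2:A'\to AB$ the coherent channel given by the isometry $\sum_{x}|x\rangle^A|x\rangle^B\langle x|^{A'}$, and $\overline{\mathrm{id}}_2:A'\to B$ the perfect classical bit channel (completely dephasing, with Kraus operators $|x\rangle^B\langle x|^{A'}$). Put $[q\to q]=\langle\mathrm{id}_2\rangle$, $[q\to qq]=\langle\Delta_2\rangle$, $[c\to c]=\langle\overline{\mathrm{id}}_2\rangle$ for the proper resources, and $[q\to q:\tau]=\langle\mathrm{id}_2:\tau\rangle$, $[q\to qq:\tau]=\langle\Delta_2:\tau\rangle$,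 $[c\to c:\tau]=\langle\overline{\mathrm{id}}_2:\tau\rangle$ for the relative ones. Then 1. $[q\to q:\tau]=[q\to q]$; 2. $[q\to qq:\tau]=[q\to qq]$; 3. $[c\to c:\tau]=[c\to c]$. -/

import Mathlib

open scoped Matrix Kronecker ComplexOrder ENNReal

namespace ResourceTheory

noncomputable section

/-! ### States

A finite quantum system with a distinguished basis is a finite type `A` (the label set of the
basis); operators on its Hilbert space are matrices `Matrix A A ℂ`, a joint system is a product
of types, and a null (one-dimensional) system is `Unit`. -/

/-- A quantum state (density operator) of the system `A`. -/
structure State (A : Type) [Fintype A] where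
  mat : Matrix A A ℂ
  posSemidef : mat.PosSemidef
  trace_eq_one : mat.trace = 1

/-- The partial trace over the first tensor factor. -/
def traceFst {A B : Type} [Fintype A] (ρ : Matrix (A × B) (A × B) ℂ) : Matrix B B ℂ :=
  Matrix.of fun b b' => ∑ a, ρ (a, b) (a, b')

/-- The partial trace over the second tensor factor. -/
def traceSnd {A B : Type} [Fintype B] (ρ : Matrix (A × B) (A × B) ℂ) : Matrix A A ℂ :=
  Matrix.of fun a a' => ∑ b, ρ (a, b) (a', b)

/-- The trace norm `‖M‖₁ = tr √(M† M)`, that is, the sum of the square roots of the eigenvalues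
of `M† M`. -/
def traceNorm {A : Type} [Fintype A] [DecidableEq A] (M : Matrix A A ℂ) : ℝ :=
  ∑ i, √((Matrix.isHermitian_conjTranspose_mul_self M).eigenvalues i)

/-- The one-dimensional state. -/
def State.unit : State Unit where
  mat := 1
  posSemidef := Matrix.PosSemidef.one
  trace_eq_one := by simp

/-- The maximally mixed state `τ = 1 / d` of a `d`-dimensional system. -/
def State.maximallyMixed (A : Type) [Fintype A] [DecidableEq A] [Nonempty A] : State A where
  mat := (Fintype.card A : ℂ)⁻¹ • 1
  posSemidef := Matrix.PosSemidef.one.smul (by positivity)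
  trace_eq_one := by simp

/-- The tensor product of two states. -/
def State.prod {A B : Type} [Fintype A] [Fintype B] (ρ : State A) (σ : State B) :
    State (A × B) where
  mat := ρ.mat ⊗ₖ σ.mat
  posSemidef := ρ.posSemidef.kronecker σ.posSemidef
  trace_eq_one := by rw [Matrix.trace_kronecker, ρ.trace_eq_one, σ.trace_eq_one, one_mul]

/-- The `n`-fold tensor power of a state. -/
def State.pow {A : Type} [Fintype A] (ρ : State A) (n : ℕ) : State (Fin n → A) where
  mat := Matrix.of fun a a' => ∏ i, ρ.mat (a i) (a' i)
  posSemidef := by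
    classical
    obtain ⟨S, hS⟩ : ∃ S : Matrix A A ℂ, ρ.mat = Sᴴ * S := by
      open scoped MatrixOrder in
      exact CStarAlgebra.nonneg_iff_eq_star_mul_self.mp ρ.posSemidef.nonneg
    have h : (Matrix.of fun a a' : Fin n → A => ∏ i, ρ.mat (a i) (a' i))
        = (Matrix.of fun a a' : Fin n → A => ∏ i, S (a i) (a' i))ᴴ
          * Matrix.of fun a a' : Fin n → A => ∏ i, S (a i) (a' i) := by
      ext a a'
      simp only [Matrix.of_apply, Matrix.mul_apply, Matrix.conjTranspose_apply, hS, star_prod,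
        ← Finset.prod_mul_distrib]
      exact Fintype.prod_sum fun i j => star (S j (a i)) * S j (a' i)
    rw [h]
    exact Matrix.posSemidef_conjTranspose_mul_self _
  trace_eq_one := by
    have h : ∑ a, ρ.mat a a = 1 := ρ.trace_eq_one
    have h' := Fintype.prod_sum fun (_ : Fin n) (a : A) => ρ.mat a a
    simp only [h, Finset.prod_const_one] at h'
    exact h'.symm

/-! ### Quantum operations -/

/-- A quantum operation (completely positive trace preserving map) from `A` to `B`, given by a
Kraus representation. The representation is not unique; everything below depends only on the
map `Channel.apply`. -/
structure Channel (A B : Type) [Fintype A] [DecidableEq A] [Fintype B] where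
  Idx : Type
  [fintypeIdx : Fintype Idx]
  kraus : Idx → Matrix B A ℂ
  tracePreserving : ∑ x, (kraus x)ᴴ * kraus x = 1

attribute [instance] Channel.fintypeIdx

namespace Channel

variable {A B C D : Type} [Fintype A] [DecidableEq A] [Fintype B] [DecidableEq B]
  [Fintype C] [DecidableEq C] [Fintype D] [DecidableEq D]

/-- The action `ρ ↦ ∑ₓ Kₓ ρ Kₓ†` of a quantum operation. -/
def apply (N : Channel A B) (ρ : Matrix A A ℂ) : Matrix B B ℂ :=
  ∑ x, N.kraus x * ρ * (N.kraus x)ᴴ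

/-- The operation `ρ ↦ V ρ V†` of an isometry `V`. -/
def ofIsometry (V : Matrix B A ℂ) (hV : Vᴴ * V = 1) : Channel A B where
  Idx := Unit
  kraus := fun _ => V
  tracePreserving := by simpa using hV

/-- The identity operation. -/
def id (A : Type) [Fintype A] [DecidableEq A] : Channel A A :=
  ofIsometry 1 (by simp)

/-- Relabelling of the basis, used only to rearrange tensor factors. -/
def ofEquiv (e : A ≃ B) : Channel A B :=
  ofIsometry (Matrix.of fun b a => if b = e a then 1 else 0) (by
    ext a a'
    simp [Matrix.mul_apply, Matrix.one_apply, eq_comm])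

/-- Composition: first `N`, then `M`. -/
def comp (M : Channel B C) (N : Channel A B) : Channel A C where
  Idx := M.Idx × N.Idx
  kraus := fun x => M.kraus x.1 * N.kraus x.2
  tracePreserving := by
    rw [Fintype.sum_prod_type_right]
    have h (y : N.Idx) : ∑ x : M.Idx, (M.kraus x * N.kraus y)ᴴ * (M.kraus x * N.kraus y)
        = (N.kraus y)ᴴ * N.kraus y := by
      have : ∀ x, (M.kraus x * N.kraus y)ᴴ * (M.kraus x * N.kraus y)
          = (N.kraus y)ᴴ * (((M.kraus x)ᴴ * M.kraus x) * N.kraus y) := fun x => by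
        simp only [Matrix.conjTranspose_mul, Matrix.mul_assoc]
      simp only [this]
      rw [← Matrix.mul_sum, ← Matrix.sum_mul, M.tracePreserving, Matrix.one_mul]
    simp only [h]
    exact N.tracePreserving

/-- The tensor product of two quantum operations. -/
def prod (M : Channel A B) (N : Channel C D) : Channel (A × C) (B × D) where
  Idx := M.Idx × N.Idx
  kraus := fun x => M.kraus x.1 ⊗ₖ N.kraus x.2
  tracePreserving := by
    simp only [Matrix.conjTranspose_kronecker, ← Matrix.mul_kronecker_mul]
    rw [Fintype.sum_prod_type, ← Matrix.one_kronecker_one, ← M.tracePreserving,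
      ← N.tracePreserving]
    ext ⟨a, c⟩ ⟨a', c'⟩
    simp [Matrix.sum_apply, Finset.sum_mul_sum]

/-- The `n`-fold tensor power of an operation from a two-part system to a two-part system, with
the corresponding parts collected. -/
def pow (N : Channel (A × B) (C × D)) (n : ℕ) :
    Channel ((Fin n → A) × (Fin n → B)) ((Fin n → C) × (Fin n → D)) where
  Idx := Fin n → N.Idx
  kraus := fun x => Matrix.of fun o p => ∏ i, N.kraus (x i) (o.1 i, o.2 i) (p.1 i, p.2 i)
  tracePreserving := by
    have h (a a' : A) (b b' : B) : ∑ x, ∑ o, star (N.kraus x o (a, b)) * N.kraus x o (a', b')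
        = if (a, b) = (a', b') then 1 else 0 := by
      have := congrFun (congrFun N.tracePreserving (a, b)) (a', b')
      simpa only [Matrix.sum_apply, Matrix.mul_apply, Matrix.conjTranspose_apply,
        Matrix.one_apply] using this
    ext ⟨a, b⟩ ⟨a', b'⟩
    simp only [Matrix.sum_apply, Matrix.mul_apply, Matrix.conjTranspose_apply, Matrix.of_apply,
      star_prod, ← Finset.prod_mul_distrib]
    have e (x : Fin n → N.Idx) :
        ∑ o : (Fin n → C) × (Fin n → D), ∏ i, star (N.kraus (x i) (o.1 i, o.2 i) (a i, b i))
          * N.kraus (x i) (o.1 i, o.2 i) (a' i, b' i)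
        = ∏ i, ∑ o, star (N.kraus (x i) o (a i, b i)) * N.kraus (x i) o (a' i, b' i) := by
      rw [Fintype.prod_sum]
      exact Fintype.sum_equiv (Equiv.arrowProdEquivProdArrow (Fin n) (fun _ => C) fun _ => D).symm
        _ _ fun _ => rfl
    simp only [e]
    rw [← Fintype.prod_sum fun i x =>
      ∑ o, star (N.kraus x o (a i, b i)) * N.kraus x o (a' i, b' i)]
    simp only [h, Matrix.one_apply, Prod.mk.injEq]
    by_cases hab : a = a' ∧ b = b'
    · simp [hab]
    · rw [if_neg hab]
      have : ∃ i, ¬ (a i = a' i ∧ b i = b' i) := by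
        by_contra! hc
        exact hab ⟨funext fun i => (hc i).1, funext fun i => (hc i).2⟩
      obtain ⟨i, hi⟩ := this
      exact Finset.prod_eq_zero (Finset.mem_univ i) (if_neg hi)

end Channel

/-- The distance `‖M - N‖_ω` of two quantum operations with input `R' × A'` relative to a state
`ω` of the subsystem `R'`: the supremum of `‖(id_R ⊗ M) ξ - (id_R ⊗ N) ξ‖₁` over all reference
systems `R` and all states `ξ` of `R`, `R'`, `A'` that extend `ω`. -/
def relDist {R' A' B : Type} [Fintype R'] [DecidableEq R'] [Fintype A'] [DecidableEq A']
    [Fintype B] [DecidableEq B] (M N : Channel (R' × A') B) (ω : State R') : ℝ≥0∞ :=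
  ⨆ (R : Type) (_ : Fintype R) (_ : DecidableEq R) (ξ : State (R × (R' × A')))
    (_ : traceSnd (traceFst ξ.mat) = ω.mat),
    ENNReal.ofReal (traceNorm
      (((Channel.id R).prod M).apply ξ.mat - ((Channel.id R).prod N).apply ξ.mat))

/-! ### Finite resources -/

/-- A finite (depth-1) dynamic resource `(N : ω)`: an operation `N : A' → A B` whose input
`A' = Rel × Abs` belongs to Alice and whose output is shared between Alice (`OutA`) and Bob
(`OutB`), with a test state `ω` on the subsystem `Rel` of the input. -/
structure FiniteResource where
  Rel : Type
  Abs : Type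
  OutA : Type
  OutB : Type
  [fintypeRel : Fintype Rel]
  [fintypeAbs : Fintype Abs]
  [fintypeOutA : Fintype OutA]
  [fintypeOutB : Fintype OutB]
  [decEqRel : DecidableEq Rel]
  [decEqAbs : DecidableEq Abs]
  [decEqOutA : DecidableEq OutA]
  [decEqOutB : DecidableEq OutB]
  op : Channel (Rel × Abs) (OutA × OutB)
  test : State Rel

attribute [instance] FiniteResource.fintypeRel FiniteResource.fintypeAbs
  FiniteResource.fintypeOutA FiniteResource.fintypeOutB FiniteResource.decEqRel
  FiniteResource.decEqAbs FiniteResource.decEqOutA FiniteResource.decEqOutB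

namespace FiniteResource

variable {A' A B : Type} [Fintype A'] [DecidableEq A'] [Fintype A] [DecidableEq A]
  [Fintype B] [DecidableEq B]

/-- The proper dynamic resource `N`: the test system is null. -/
def proper (N : Channel A' (A × B)) : FiniteResource where
  Rel := Unit
  Abs := A'
  OutA := A
  OutB := B
  op := N.comp (Channel.ofEquiv (Equiv.punitProd A'))
  test := State.unit

/-- The relative dynamic resource `(N : ω)`: the test system is the whole input. -/
def relative (N : Channel A' (A × B)) (ω : State A') : FiniteResource where
  Rel := A'
  Abs := Unit
  OutA := A
  OutB := B
  op := N.comp (Channel.ofEquiv (Equiv.prodPUnit A'))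
  test := ω

/-- The trivial resource, on null systems. -/
def trivial : FiniteResource where
  Rel := Unit
  Abs := Unit
  OutA := Unit
  OutB := Unit
  op := Channel.id (Unit × Unit)
  test := State.unit

/-- The tensor product `(N₁ ⊗ N₂ : ω₁ ⊗ ω₂)`. -/
def tensor (r s : FiniteResource) : FiniteResource where
  Rel := r.Rel × s.Rel
  Abs := r.Abs × s.Abs
  OutA := r.OutA × s.OutA
  OutB := r.OutB × s.OutB
  op := (Channel.ofEquiv (Equiv.prodProdProdComm r.OutA r.OutB s.OutA s.OutB)).comp
    ((r.op.prod s.op).comp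
      (Channel.ofEquiv (Equiv.prodProdProdComm r.Rel s.Rel r.Abs s.Abs)))
  test := r.test.prod s.test

/-- The tensor power `(N : ω)^{⊗ n}`. -/
def pow (r : FiniteResource) (n : ℕ) : FiniteResource where
  Rel := Fin n → r.Rel
  Abs := Fin n → r.Abs
  OutA := Fin n → r.OutA
  OutB := Fin n → r.OutB
  op := r.op.pow n
  test := r.test.pow n

end FiniteResource

/-- A finite depth-`ℓ` resource, a collection of `ℓ` component resources. The order of the list
carries no meaning: a protocol may use the components in any order. -/
abbrev DepthResource := List FiniteResource

/-- The depth-`kℓ` resource `α^{× k}` consisting of `k` copies of a depth-`ℓ` resource. -/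
def DepthResource.times (k : ℕ) (α : DepthResource) : DepthResource :=
  (List.replicate k α).flatten

/-- The result `S[α]` of the standard protocol: the tensor product of all components. -/
def DepthResource.standard : DepthResource → FiniteResource
  | [] => FiniteResource.trivial
  | [r] => r
  | r :: s :: l => r.tensor (DepthResource.standard (s :: l))

/-! ### Protocols -/

/-- The part of a protocol that remains to be carried out, when the resources in the list are
still to be used (in this order), Alice holds the system `M` (the output of the last resource
and her auxiliary system), and Bob holds the system `W` (all outputs received so far).

* `step`: Alice performs a local isometry `M → A'ᵢ A^aux`, then the next resource
  is applied to `A'ᵢ`, producing an output for Alice and one for Bob.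
* `finish`: Alice and Bob perform final local operations. -/
inductive Steps (OA OB : Type) [Fintype OA] [DecidableEq OA] [Fintype OB] [DecidableEq OB] :
    List FiniteResource → (M W : Type) → [Fintype M] → [DecidableEq M] →
      [Fintype W] → [DecidableEq W] → Type 1
  | finish {M W : Type} [Fintype M] [DecidableEq M] [Fintype W] [DecidableEq W]
      (encode : Channel M OA) (decode : Channel W OB) : Steps OA OB [] M W
  | step {M W : Type} [Fintype M] [DecidableEq M] [Fintype W] [DecidableEq W]
      {r : FiniteResource} {rs : List FiniteResource}
      (Aux : Type) [Fintype Aux] [DecidableEq Aux]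
      (V : Matrix ((r.Rel × r.Abs) × Aux) M ℂ) (isometry : Vᴴ * V = 1)
      (next : Steps OA OB rs (r.OutA × Aux) (r.OutB × W)) : Steps OA OB (r :: rs) M W

namespace Steps

variable {OA OB : Type} [Fintype OA] [DecidableEq OA] [Fintype OB] [DecidableEq OB]

/-- Alice's local isometry `M → A' A^aux`, with the bystanding systems collected on the right. -/
def encodeStep {r : FiniteResource} {M W Aux : Type} [Fintype M] [DecidableEq M]
    [Fintype W] [DecidableEq W] [Fintype Aux] [DecidableEq Aux]
    (V : Matrix ((r.Rel × r.Abs) × Aux) M ℂ) (hV : Vᴴ * V = 1) :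
    Channel (M × W) ((r.Rel × r.Abs) × (Aux × W)) :=
  (Channel.ofEquiv (Equiv.prodAssoc (r.Rel × r.Abs) Aux W)).comp
    ((Channel.ofIsometry V hV).prod (Channel.id W))

/-- The application of a resource to its input `A'`, with the outputs handed to Alice and Bob. -/
def useStep (r : FiniteResource) (Aux W : Type) [Fintype Aux] [DecidableEq Aux]
    [Fintype W] [DecidableEq W] :
    Channel ((r.Rel × r.Abs) × (Aux × W)) ((r.OutA × Aux) × (r.OutB × W)) :=
  (Channel.ofEquiv (Equiv.prodProdProdComm r.OutA r.OutB Aux W)).comp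
    (r.op.prod (Channel.id (Aux × W)))

/-- The overall quantum operation carried out by the remaining steps. -/
def channel {rs : List FiniteResource} {M W : Type} [Fintype M] [DecidableEq M]
    [Fintype W] [DecidableEq W] : Steps OA OB rs M W → Channel (M × W) (OA × OB)
  | finish encode decode => encode.prod decode
  | step (r := r) Aux V hV next =>
      next.channel.comp ((useStep r Aux W).comp (encodeStep V hV))

/-- `η`-validity of the remaining steps when the present joint state of Alice and Bob is `σ`:
before each use of a resource the restriction of the state to its test system is `η`-close to
its test state. -/
def Valid (η : ℝ) {rs : List FiniteResource} {M W : Type} [Fintype M] [DecidableEq M]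
    [Fintype W] [DecidableEq W] :
    Steps OA OB rs M W → Matrix (M × W) (M × W) ℂ → Prop
  | finish _ _, _ => True
  | step (r := r) Aux V hV next, σ =>
      traceNorm (traceSnd (traceSnd ((encodeStep V hV).apply σ)) - r.test.mat) ≤ η ∧
        next.Valid η ((useStep r Aux W).apply ((encodeStep V hV).apply σ))

end Steps

/-- A protocol consuming the resource `α`, with input system `In` of Alice and output systems
`OA` of Alice and `OB` of Bob: a choice of an order in which the components of `α` are used,
an initial local operation of Alice, and the subsequent steps. -/
structure Protocol (α : DepthResource) (In OA OB : Type) [Fintype In] [DecidableEq In]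
    [Fintype OA] [DecidableEq OA] [Fintype OB] [DecidableEq OB] where
  order : List FiniteResource
  perm : order.Perm α
  Mem : Type
  [fintypeMem : Fintype Mem]
  [decEqMem : DecidableEq Mem]
  init : Channel In Mem
  steps : Steps OA OB order Mem Unit

attribute [instance] Protocol.fintypeMem Protocol.decEqMem

namespace Protocol

variable {α : DepthResource} {In OA OB : Type} [Fintype In] [DecidableEq In]
    [Fintype OA] [DecidableEq OA] [Fintype OB] [DecidableEq OB]

/-- The initial operation; Bob starts with a null system. -/
def start (P : Protocol α In OA OB) : Channel In (P.Mem × Unit) :=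
  (Channel.ofEquiv (Equiv.prodPUnit P.Mem).symm).comp P.init

/-- The quantum operation which the protocol simulates from the consumed resource. -/
def channel (P : Protocol α In OA OB) : Channel In (OA × OB) :=
  P.steps.channel.comp P.start

/-- A protocol whose created resource has the test state `Ω` is `η`-valid if, for every
extension `ξ` of `Ω`, each consumed resource is applied to an input whose restriction to the
test system is `η`-close to the test state of that resource. (The reference system `R` plays no
role in these restrictions, and is traced out at once.) -/
def Valid {Rel Abs : Type} [Fintype Rel] [DecidableEq Rel] [Fintype Abs] [DecidableEq Abs]
    (P : Protocol α (Rel × Abs) OA OB) (Ω : State Rel) (η : ℝ) : Prop :=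
  ∀ (R : Type) [Fintype R] (ξ : State (R × (Rel × Abs))),
    traceSnd (traceFst ξ.mat) = Ω.mat →
      P.steps.Valid η (P.start.apply (traceFst ξ.mat))

end Protocol

/-! ### Asymptotic resources -/

/-- A sequence of finite resources `(α_n)_n`. The inequality below makes sense for every such
sequence; it is used here only for i.i.d. sequences. -/
abbrev ResourceSequence := ℕ → DepthResource

/-- The i.i.d. resource `⟨N : ω⟩ = ((N : ω)^{⊗ n})_n`. -/
def iid (r : FiniteResource) : ResourceSequence := fun n => [r.pow n]

/-- The asymptotic resource inequality `α ≥ β`: for every inefficiency `δ` there is a number `k`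
of blocks such that for every `ε` and all large `n` some `ε`-valid protocol on
`(α_{⌊n/k⌋})^{× k}` simulates `S[β_{⌊(1-δ)n⌋}]` up to distance `ε`. -/
def ResourceSequence.Ge (α β : ResourceSequence) : Prop :=
  ∀ δ : ℝ, 0 < δ → ∃ k : ℕ, 0 < k ∧ ∀ ε : ℝ, 0 < ε → ∃ n₀ : ℕ, ∀ n : ℕ, n₀ ≤ n →
    let target := DepthResource.standard (β ⌊(1 - δ) * n⌋₊)
    ∃ P : Protocol (DepthResource.times k (α (n / k)))
        (target.Rel × target.Abs) target.OutA target.OutB,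
      P.Valid target.test ε ∧
        relDist P.channel target.op target.test ≤ ENNReal.ofReal ε

/-- Equivalence (equality) of asymptotic resources: `α ≥ β` and `β ≥ α`. -/
def ResourceSequence.Equivalent (α β : ResourceSequence) : Prop :=
  α.Ge β ∧ β.Ge α

/-! ### The unit resources -/

/-- The perfect quantum channel `id_d : A' → B`. -/
def idChannel (d : ℕ) : Channel (Fin d) (Unit × Fin d) :=
  Channel.ofIsometry (Matrix.of fun o x => if o.2 = x then 1 else 0) (by
    ext a a'
    rw [Matrix.mul_apply, Fintype.sum_prod_type]
    by_cases h : a = a' <;> simp [Matrix.one_apply, h, eq_comm])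

/-- The coherent channel `Δ_d : A' → A B`, given by the isometry `∑ₓ |x⟩|x⟩⟨x|`. -/
def coherentChannel (d : ℕ) : Channel (Fin d) (Fin d × Fin d) :=
  Channel.ofIsometry (Matrix.of fun o x => if o.1 = x ∧ o.2 = x then 1 else 0) (by
    ext a a'
    rw [Matrix.mul_apply, Fintype.sum_prod_type]
    by_cases h : a = a' <;> simp [Matrix.one_apply, ite_and, h, eq_comm])

/-- The perfect classical channel `A' → B`, that is, the completely dephasing channel with Kraus
operators `|x⟩⟨x|`. -/
def classicalChannel (d : ℕ) : Channel (Fin d) (Unit × Fin d) where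
  Idx := Fin d
  kraus := fun y => Matrix.of fun o x => if o.2 = y ∧ x = y then 1 else 0
  tracePreserving := by
    ext a a'
    simp [Matrix.sum_apply, Matrix.mul_apply, Matrix.one_apply, Fintype.sum_prod_type, ite_and,
      eq_comm]

/-- `[q → q]`. -/
def qubit : ResourceSequence := iid (FiniteResource.proper (idChannel 2))

/-- `[q → qq]`. -/
def cobit : ResourceSequence := iid (FiniteResource.proper (coherentChannel 2))

/-- `[c → c]`. -/
def cbit : ResourceSequence := iid (FiniteResource.proper (classicalChannel 2))

/-- `[q → q : τ]`. -/
def qubitRel : ResourceSequence :=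
  iid (FiniteResource.relative (idChannel 2) (State.maximallyMixed (Fin 2)))

/-- `[q → qq : τ]`. -/
def cobitRel : ResourceSequence :=
  iid (FiniteResource.relative (coherentChannel 2) (State.maximallyMixed (Fin 2)))

/-- `[c → c : τ]`. -/
def cbitRel : ResourceSequence :=
  iid (FiniteResource.relative (classicalChannel 2) (State.maximallyMixed (Fin 2)))

end

end ResourceTheory

open scoped Matrix Kronecker ComplexOrder ENNReal

namespace ResourceTheory

noncomputable section

set_option linter.unusedSectionVars false

set_option synthInstance.maxSize 1000

/-! ### Kernels of quantum operations -/

namespace Channel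

variable {A B C D : Type} [Fintype A] [DecidableEq A] [Fintype B] [DecidableEq B]
  [Fintype C] [DecidableEq C] [Fintype D] [DecidableEq D]

/-- The matrix entries of a quantum operation as a linear map on matrices: the entry at
`(b, b')` of the image of the matrix unit `|a⟩⟨a'|`. -/
def kernel (N : Channel A B) (b b' : B) (a a' : A) : ℂ :=
  ∑ x, N.kraus x b a * star (N.kraus x b' a')

theorem apply_apply (N : Channel A B) (ρ : Matrix A A ℂ) (b b' : B) :
    N.apply ρ b b' = ∑ a, ∑ a', N.kernel b b' a a' * ρ a a' := by
  simp only [apply, Matrix.sum_apply, Matrix.mul_apply, Matrix.conjTranspose_apply, kernel,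
    Finset.sum_mul]
  rw [Finset.sum_congr rfl fun a _ => Finset.sum_comm, Finset.sum_comm]
  refine Finset.sum_congr rfl fun x _ => ?_
  rw [Finset.sum_comm]
  refine Finset.sum_congr rfl fun a _ => Finset.sum_congr rfl fun a' _ => ?_
  ring

theorem kernel_ofIsometry (V : Matrix B A ℂ) (hV : Vᴴ * V = 1) (b b' : B) (a a' : A) :
    (ofIsometry V hV).kernel b b' a a' = V b a * star (V b' a') := by
  exact Fintype.sum_unique (ι := Unit) _

theorem kernel_comp (M : Channel B C) (N : Channel A B) (c c' : C) (a a' : A) :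
    (M.comp N).kernel c c' a a'
      = ∑ b, ∑ b', M.kernel c c' b b' * N.kernel b b' a a' := by
  have h : ∀ x y, (M.kraus x * N.kraus y) c a * star ((M.kraus x * N.kraus y) c' a')
      = ∑ b, ∑ b', (M.kraus x c b * star (M.kraus x c' b'))
        * (N.kraus y b a * star (N.kraus y b' a')) := fun x y => by
    simp only [Matrix.mul_apply, star_sum, star_mul', Finset.sum_mul_sum]
    refine Finset.sum_congr rfl fun b _ => Finset.sum_congr rfl fun b' _ => ?_
    ring
  change ∑ x : M.Idx × N.Idx, (M.kraus x.1 * N.kraus x.2) c a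
    * star ((M.kraus x.1 * N.kraus x.2) c' a') = _
  simp only [h, kernel, Finset.sum_mul_sum, Fintype.sum_prod_type]
  rw [Finset.sum_congr rfl fun x _ => Finset.sum_comm, Finset.sum_comm]
  refine Finset.sum_congr rfl fun b _ => ?_
  rw [Finset.sum_congr rfl fun x _ => Finset.sum_comm, Finset.sum_comm]

theorem kernel_prod (M : Channel A B) (N : Channel C D) (o o' : B × D) (i i' : A × C) :
    (M.prod N).kernel o o' i i'
      = M.kernel o.1 o'.1 i.1 i'.1 * N.kernel o.2 o'.2 i.2 i'.2 := by
  change ∑ x : M.Idx × N.Idx, (M.kraus x.1 ⊗ₖ N.kraus x.2) o i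
    * star ((M.kraus x.1 ⊗ₖ N.kraus x.2) o' i') = _
  simp only [kernel, Fintype.sum_prod_type, Finset.sum_mul_sum, Matrix.kroneckerMap_apply,
    star_mul']
  refine Finset.sum_congr rfl fun x _ => Finset.sum_congr rfl fun y _ => ?_
  ring

theorem kernel_pow (N : Channel (A × B) (C × D)) (n : ℕ)
    (o o' : (Fin n → C) × (Fin n → D)) (p p' : (Fin n → A) × (Fin n → B)) :
    (N.pow n).kernel o o' p p'
      = ∏ i, N.kernel (o.1 i, o.2 i) (o'.1 i, o'.2 i) (p.1 i, p.2 i) (p'.1 i, p'.2 i) := by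
  simp only [kernel]
  rw [Fintype.prod_sum]
  change ∑ x : Fin n → N.Idx, (∏ i, N.kraus (x i) (o.1 i, o.2 i) (p.1 i, p.2 i))
    * star (∏ i, N.kraus (x i) (o'.1 i, o'.2 i) (p'.1 i, p'.2 i)) = _
  simp only [star_prod, ← Finset.prod_mul_distrib]

theorem apply_congr {M N : Channel A B} (h : M.kernel = N.kernel) (ρ : Matrix A A ℂ) :
    M.apply ρ = N.apply ρ := by
  ext b b'
  simp only [apply_apply, h]

/-! ### Monomial operations and their mixtures -/

/-- The operation maps every matrix unit `|a⟩⟨a'|` to the multiple `g a a'` of the matrix unit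
`|f a⟩⟨f a'|`. -/
def IsMonomial (N : Channel A B) (f : A → B) (g : A → A → ℂ) : Prop :=
  ∀ b b' a a', N.kernel b b' a a' = if b = f a ∧ b' = f a' then g a a' else 0

/-- The operation maps every matrix unit `|a⟩⟨a'|` to the sum over `κ` of the multiples
`w κ a a'` of the matrix units `|f κ a⟩⟨f κ a'|`. -/
def IsMixture {K : Type} [Fintype K] (N : Channel A B) (f : K → A → B)
    (w : K → A → A → ℂ) : Prop :=
  ∀ b b' a a', N.kernel b b' a a' = ∑ κ, if b = f κ a ∧ b' = f κ a' then w κ a a' else 0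

theorem IsMonomial.congr {N : Channel A B} {f f' : A → B} {g g' : A → A → ℂ}
    (h : N.IsMonomial f g) (hf : ∀ a, f a = f' a) (hg : ∀ a a', g a a' = g' a a') :
    N.IsMonomial f' g' := by
  intro b b' a a'
  rw [h b b' a a', hf, hf, hg]

theorem isMonomial_ofEquiv (e : A ≃ B) : (ofEquiv e).IsMonomial e fun _ _ => 1 := by
  intro b b' a a'
  rw [ofEquiv, kernel_ofIsometry]
  by_cases h : b = e a <;> by_cases h' : b' = e a' <;> simp [h, h']

theorem isMonomial_id : (Channel.id A).IsMonomial (fun a => a) fun _ _ => 1 := by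
  intro b b' a a'
  rw [Channel.id, kernel_ofIsometry, Matrix.one_apply, Matrix.one_apply]
  by_cases h : b = a <;> by_cases h' : b' = a' <;> simp [h, h']

theorem IsMixture.comp {K : Type} [Fintype K] {M : Channel B C} {N : Channel A B}
    {f : K → A → B} {w : K → A → A → ℂ} {f' : B → C} {g : B → B → ℂ}
    (hM : M.IsMonomial f' g) (hN : N.IsMixture f w) :
    (M.comp N).IsMixture (fun κ a => f' (f κ a))
      fun κ a a' => w κ a a' * g (f κ a) (f κ a') := by
  intro c c' a a'
  have h (b b' : B) : M.kernel c c' b b' * N.kernel b b' a a'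
      = ∑ κ, if b' = f κ a' then (if b = f κ a then
          (if c = f' (f κ a) ∧ c' = f' (f κ a') then w κ a a' * g (f κ a) (f κ a') else 0)
          else 0) else 0 := by
    rw [hM, hN, Finset.mul_sum]
    refine Finset.sum_congr rfl fun κ _ => ?_
    by_cases h₁ : b = f κ a <;> by_cases h₂ : b' = f κ a' <;> simp [h₁, h₂, mul_comm]
  simp only [kernel_comp, h]
  rw [Finset.sum_congr rfl fun b _ => Finset.sum_comm, Finset.sum_comm]
  simp

theorem IsMonomial.isMixture {N : Channel A B} {f : A → B} {g : A → A → ℂ}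
    (h : N.IsMonomial f g) : N.IsMixture (fun _ : Unit => f) fun _ => g := by
  intro b b' a a'
  simp [h b b' a a']

theorem IsMonomial.comp {M : Channel B C} {N : Channel A B}
    {f : A → B} {g : A → A → ℂ} {f' : B → C} {g' : B → B → ℂ}
    (hM : M.IsMonomial f' g') (hN : N.IsMonomial f g) :
    (M.comp N).IsMonomial (fun a => f' (f a)) fun a a' => g a a' * g' (f a) (f a') := by
  intro c c' a a'
  simpa using IsMixture.comp hM hN.isMixture c c' a a'

theorem IsMonomial.prod {M : Channel A B} {N : Channel C D}
    {f : A → B} {g : A → A → ℂ} {f' : C → D} {g' : C → C → ℂ}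
    (hM : M.IsMonomial f g) (hN : N.IsMonomial f' g') :
    (M.prod N).IsMonomial (fun p => (f p.1, f' p.2))
      fun p p' => g p.1 p'.1 * g' p.2 p'.2 := by
  rintro ⟨b, d⟩ ⟨b', d'⟩ ⟨a, c⟩ ⟨a', c'⟩
  rw [kernel_prod, hM, hN, ite_zero_mul_ite_zero]
  refine if_congr ?_ rfl rfl
  simp only [Prod.mk.injEq]
  tauto

theorem IsMonomial.pow {N : Channel (A × B) (C × D)} {f : A × B → C × D}
    {g : A × B → A × B → ℂ} (hN : N.IsMonomial f g) (n : ℕ) :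
    (N.pow n).IsMonomial
      (fun p => (fun i => (f (p.1 i, p.2 i)).1, fun i => (f (p.1 i, p.2 i)).2))
      fun p p' => ∏ i, g (p.1 i, p.2 i) (p'.1 i, p'.2 i) := by
  intro o o' p p'
  rw [kernel_pow]
  simp only [hN _ _ _ _]
  split_ifs with h
  · obtain ⟨rfl, rfl⟩ := h
    simp
  · rw [Finset.prod_ite_zero, if_neg]
    refine fun hc => h ⟨?_, ?_⟩
    · exact Prod.ext (funext fun i => congrArg Prod.fst (hc i (Finset.mem_univ i)).1)
        (funext fun i => congrArg Prod.snd (hc i (Finset.mem_univ i)).1)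
    · exact Prod.ext (funext fun i => congrArg Prod.fst (hc i (Finset.mem_univ i)).2)
        (funext fun i => congrArg Prod.snd (hc i (Finset.mem_univ i)).2)

/-- The operation whose Kraus operator number `s` is `∑ₐ w s a |f s a⟩⟨a|`. -/
def ofPartialMaps {S : Type} [Fintype S] (f : S → A → B) (w : S → A → ℂ)
    (h : ∀ a a', (∑ s, if f s a = f s a' then star (w s a) * w s a' else 0)
      = if a = a' then 1 else 0) : Channel A B where
  Idx := S
  kraus := fun s => Matrix.of fun b a => if b = f s a then w s a else 0
  tracePreserving := by
    ext a a'
    rw [Matrix.one_apply, ← h a a', Matrix.sum_apply]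
    refine Finset.sum_congr rfl fun s _ => ?_
    simp only [Matrix.mul_apply, Matrix.conjTranspose_apply, Matrix.of_apply]
    rw [Finset.sum_eq_single (f s a)]
    · by_cases hs : f s a = f s a' <;> simp [hs]
    · intro b _ hb
      simp [hb]
    · simp

theorem isMixture_ofPartialMaps {S : Type} [Fintype S] (f : S → A → B) (w : S → A → ℂ)
    (h : ∀ a a', (∑ s, if f s a = f s a' then star (w s a) * w s a' else 0)
      = if a = a' then 1 else 0) :
    (ofPartialMaps f w h).IsMixture f fun s a a' => w s a * star (w s a') := by
  intro b b' a a'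
  refine Finset.sum_congr rfl fun s _ => ?_
  change (if b = f s a then w s a else 0) * star (if b' = f s a' then w s a' else 0) = _
  by_cases h₁ : b = f s a <;> by_cases h₂ : b' = f s a' <;> simp [h₁, h₂]

/-- A uniformly random key selects one of several monomial isometries. -/
theorem exists_isMixture {K : Type} [Fintype K] [Nonempty K] (f : K → A → B) (φ : K → A → ℂ)
    (hf : ∀ κ, Function.Injective (f κ)) (hφ : ∀ κ a, star (φ κ a) * φ κ a = 1) :
    ∃ N : Channel A B, N.IsMixture f
      fun κ a a' => (Fintype.card K : ℂ)⁻¹ * (φ κ a * star (φ κ a')) := by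
  have hc : (((√(Fintype.card K))⁻¹ : ℝ) : ℂ) * (((√(Fintype.card K))⁻¹ : ℝ) : ℂ)
      = (Fintype.card K : ℂ)⁻¹ := by
    rw [← Complex.ofReal_mul, ← mul_inv, Real.mul_self_sqrt (by positivity)]
    simp
  refine ⟨ofPartialMaps f (fun κ a => (((√(Fintype.card K))⁻¹ : ℝ) : ℂ) * φ κ a) ?_, ?_⟩
  · intro a a'
    by_cases h : a = a'
    · subst h
      have : ∀ κ : K, star ((((√(Fintype.card K))⁻¹ : ℝ) : ℂ) * φ κ a)
          * ((((√(Fintype.card K))⁻¹ : ℝ) : ℂ) * φ κ a) = (Fintype.card K : ℂ)⁻¹ := fun κ => by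
        rw [star_mul', Complex.star_def, Complex.conj_ofReal, mul_mul_mul_comm, hc,
          ← Complex.star_def, hφ, mul_one]
      simp only [this, if_true]
      simp
    · simp [h, fun κ => (hf κ).ne h]
  · intro b b' a a'
    rw [isMixture_ofPartialMaps]
    refine Finset.sum_congr rfl fun κ _ => if_congr Iff.rfl ?_ rfl
    change _ * φ κ a * star (_ * φ κ a') = _
    rw [star_mul', Complex.star_def, Complex.conj_ofReal, mul_mul_mul_comm, hc]

/-- A monomial operation that discards the information `d a`. -/
theorem exists_isMonomial {S : Type} [Fintype S] [DecidableEq S] (f : A → B) (d : A → S)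
    (φ : A → ℂ) (hf : Function.Injective fun a => (f a, d a))
    (hφ : ∀ a, star (φ a) * φ a = 1) :
    ∃ N : Channel A B, N.IsMonomial f
      fun a a' => if d a = d a' then φ a * star (φ a') else 0 := by
  refine ⟨ofPartialMaps (fun _ : S => f) (fun s a => if s = d a then φ a else 0) ?_, ?_⟩
  · intro a a'
    have (s : S) : (if f a = f a' then star (if s = d a then φ a else 0)
        * (if s = d a' then φ a' else 0) else 0)
        = if s = d a then (if f a = f a' ∧ d a = d a' then star (φ a) * φ a' else 0) else 0 := by
      by_cases h₁ : f a = f a' <;> by_cases h₂ : s = d a <;> simp [h₁, h₂]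
    simp only [this, Finset.sum_ite_eq', Finset.mem_univ, if_true]
    by_cases h : a = a'
    · subst h
      simp only [and_self, if_true, hφ]
    · rw [if_neg h, if_neg fun hc => h (hf (Prod.ext hc.1 hc.2))]
  · intro b b' a a'
    rw [isMixture_ofPartialMaps]
    have (s : S) : (if b = f a ∧ b' = f a' then (if s = d a then φ a else 0)
        * star (if s = d a' then φ a' else 0) else 0)
        = if s = d a then (if b = f a ∧ b' = f a' then
            (if d a = d a' then φ a * star (φ a') else 0) else 0) else 0 := by
      by_cases h₁ : b = f a ∧ b' = f a' <;> by_cases h₂ : s = d a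
      · subst h₂
        by_cases h₃ : d a = d a' <;> simp [h₁, h₃]
      all_goals simp [h₁, h₂]
    simp only [this, Finset.sum_ite_eq', Finset.mem_univ, if_true]

end Channel

/-! ### Linear functionals -/

/-- The value `∑ χ s s' σ s s'` of a linear functional on matrices. -/
def pairing {S : Type} [Fintype S] (χ : S → S → ℂ) (σ : Matrix S S ℂ) : ℂ :=
  ∑ s, ∑ s', σ s s' * χ s s'

theorem pairing_apply_of_isMixture {A B K : Type} [Fintype A] [DecidableEq A] [Fintype B]
    [DecidableEq B] [Fintype K] {N : Channel A B} {f : K → A → B} {w : K → A → A → ℂ}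
    (hN : N.IsMixture f w) (χ : B → B → ℂ) (ρ : Matrix A A ℂ) :
    pairing χ (N.apply ρ)
      = pairing (fun a a' => ∑ κ, w κ a a' * χ (f κ a) (f κ a')) ρ := by
  have h (a a' : A) : ∑ κ, w κ a a' * χ (f κ a) (f κ a')
      = ∑ b, ∑ b', N.kernel b b' a a' * χ b b' := by
    have (b b' : B) : N.kernel b b' a a' * χ b b' = ∑ κ, if b' = f κ a' then
        (if b = f κ a then w κ a a' * χ (f κ a) (f κ a') else 0) else 0 := by
      rw [hN, Finset.sum_mul]
      refine Finset.sum_congr rfl fun κ _ => ?_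
      by_cases h₁ : b = f κ a <;> by_cases h₂ : b' = f κ a' <;> simp [h₁, h₂]
    simp only [this]
    rw [Finset.sum_congr rfl fun b _ => Finset.sum_comm, Finset.sum_comm]
    simp
  simp only [pairing, h, Channel.apply_apply, Finset.sum_mul, Finset.mul_sum]
  rw [Finset.sum_congr rfl fun b _ => Finset.sum_comm, Finset.sum_comm]
  refine Finset.sum_congr rfl fun a _ => ?_
  rw [Finset.sum_congr rfl fun b _ => Finset.sum_congr rfl fun b' _ => rfl,
    Finset.sum_congr rfl fun b _ => Finset.sum_comm, Finset.sum_comm]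
  refine Finset.sum_congr rfl fun a' _ => Finset.sum_congr rfl fun b _ =>
    Finset.sum_congr rfl fun b' _ => ?_
  ring

theorem pairing_apply_of_isMonomial {A B : Type} [Fintype A] [DecidableEq A] [Fintype B]
    [DecidableEq B] {N : Channel A B} {f : A → B} {g : A → A → ℂ}
    (hN : N.IsMonomial f g) (χ : B → B → ℂ) (ρ : Matrix A A ℂ) :
    pairing χ (N.apply ρ) = pairing (fun a a' => g a a' * χ (f a) (f a')) ρ := by
  simpa using pairing_apply_of_isMixture hN.isMixture χ ρ

theorem pairing_diagonal {S : Type} [Fintype S] [DecidableEq S] (c : ℂ) (σ : Matrix S S ℂ) :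
    pairing (fun s s' => if s = s' then c else 0) σ = σ.trace * c := by
  simp [pairing, Matrix.trace, Finset.sum_mul]

theorem traceNorm_zero {A : Type} [Fintype A] [DecidableEq A] :
    traceNorm (0 : Matrix A A ℂ) = 0 := by
  have h : (Matrix.isHermitian_conjTranspose_mul_self (0 : Matrix A A ℂ)).eigenvalues = 0 :=
    (Matrix.IsHermitian.eigenvalues_eq_zero_iff _).mpr (by simp)
  rw [traceNorm, h]
  simp

theorem relDist_eq_zero {R' A' B : Type} [Fintype R'] [DecidableEq R'] [Fintype A']
    [DecidableEq A'] [Fintype B] [DecidableEq B] {M N : Channel (R' × A') B} (ω : State R')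
    (h : M.kernel = N.kernel) : relDist M N ω = 0 := by
  simp only [relDist, ENNReal.iSup_eq_zero]
  intro R _ _ ξ _
  have : ((Channel.id R).prod M).apply ξ.mat = ((Channel.id R).prod N).apply ξ.mat :=
    Channel.apply_congr (by funext o o' i i'; rw [Channel.kernel_prod, Channel.kernel_prod, h]) _
  rw [this, sub_self, traceNorm_zero, ENNReal.ofReal_zero]

theorem trace_traceFst {A B : Type} [Fintype A] [Fintype B] (ρ : Matrix (A × B) (A × B) ℂ) :
    (traceFst ρ).trace = ρ.trace := by
  simp only [Matrix.trace, traceFst, Matrix.diag_apply, Matrix.of_apply]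
  rw [Finset.sum_comm, Fintype.sum_prod_type]

/-! ### Using several copies of a resource in parallel -/

/-- Splitting off the first component of a tuple. -/
def splitFirst (X Y : Type) (j : ℕ) : (Fin (j + 1) → X) × Y ≃ X × ((Fin j → X) × Y) where
  toFun q := (q.1 0, (fun i => q.1 i.succ, q.2))
  invFun p := (Fin.cons p.1 p.2.1, p.2.2)
  left_inv q := Prod.ext (Fin.cons_self_tail q.1) rfl
  right_inv p := by simp

/-- Putting a further component in front of a tuple. -/
def joinFirst (X Y : Type) (j : ℕ) : (Fin j → X) × (X × Y) ≃ (Fin (j + 1) → X) × Y where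
  toFun p := (Fin.cons p.2.1 p.1, p.2.2)
  invFun q := (fun i => q.1 i.succ, (q.1 0, q.2))
  left_inv p := by simp
  right_inv q := Prod.ext (Fin.cons_self_tail q.1) rfl

/-- The matrix of a relabelling is an isometry. -/
theorem isometry_relabelling {A B : Type} [Fintype A] [DecidableEq A] [Fintype B]
    [DecidableEq B] (e : A ≃ B) :
    (Matrix.of fun b a => if b = e a then (1 : ℂ) else 0)ᴴ
      * (Matrix.of fun b a => if b = e a then (1 : ℂ) else 0) = 1 := by
  ext a a'
  simp [Matrix.mul_apply, Matrix.one_apply, eq_comm]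

/-- Exchange of the first two of three systems. -/
def swapFirst (X Y Z : Type) : X × (Y × Z) ≃ Y × (X × Z) where
  toFun p := (p.2.1, (p.1, p.2.2))
  invFun p := (p.2.1, (p.1, p.2.2))
  left_inv _ := rfl
  right_inv _ := rfl

namespace Steps

variable {OA OB : Type} [Fintype OA] [DecidableEq OA] [Fintype OB] [DecidableEq OB]

theorem isMonomial_encodeStep {r : FiniteResource} {M W Aux : Type} [Fintype M]
    [DecidableEq M] [Fintype W] [DecidableEq W] [Fintype Aux] [DecidableEq Aux]
    (e : M ≃ (r.Rel × r.Abs) × Aux)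
    (hV : (Matrix.of fun b a => if b = e a then (1 : ℂ) else 0)ᴴ
      * (Matrix.of fun b a => if b = e a then (1 : ℂ) else 0) = 1) :
    (encodeStep (W := W) (Matrix.of fun b a => if b = e a then (1 : ℂ) else 0) hV).IsMonomial
      (fun s => ((e s.1).1, ((e s.1).2, s.2))) fun _ _ => 1 :=
  ((Channel.isMonomial_ofEquiv _).comp
    ((Channel.isMonomial_ofEquiv e).prod Channel.isMonomial_id)).congr
    (fun _ => rfl) (by simp)

theorem isMonomial_useStep {r : FiniteResource} {fa : r.Rel × r.Abs → r.OutA}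
    {fb : r.Rel × r.Abs → r.OutB} {g : r.Rel × r.Abs → r.Rel × r.Abs → ℂ}
    (hr : r.op.IsMonomial (fun p => (fa p, fb p)) g)
    (Aux W : Type) [Fintype Aux] [DecidableEq Aux] [Fintype W] [DecidableEq W] :
    (useStep r Aux W).IsMonomial (fun s => ((fa s.1, s.2.1), (fb s.1, s.2.2)))
      fun s s' => g s.1 s'.1 :=
  ((Channel.isMonomial_ofEquiv _).comp (hr.prod Channel.isMonomial_id)).congr
    (fun _ => rfl) (by simp)

/-- Alice holds `j` input blocks and a further system `Keep`; each block is fed into one copy of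
the resource `r`, and the outputs are processed at the end. -/
def useAll (r : FiniteResource) : (j : ℕ) → {M Keep W : Type} →
    [Fintype M] → [DecidableEq M] → [Fintype Keep] → [DecidableEq Keep] →
    [Fintype W] → [DecidableEq W] →
    (M ≃ (Fin j → r.Rel × r.Abs) × Keep) →
    Channel ((Fin j → r.OutA) × Keep) OA → Channel ((Fin j → r.OutB) × W) OB →
    Steps OA OB (List.replicate j r) M W
  | 0, _, Keep, W, _, _, _, _, _, _, e, enc, dec =>
      finish
        (enc.comp (Channel.ofEquiv
          (e.trans ((Equiv.ofUnique _ _).prodCongr (Equiv.refl Keep)))))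
        (dec.comp (Channel.ofEquiv (Equiv.uniqueProd W (Fin 0 → r.OutB)).symm))
  | j + 1, _, Keep, W, _, _, _, _, _, _, e, enc, dec =>
      step ((Fin j → r.Rel × r.Abs) × Keep)
        (Matrix.of fun b a => if b = (e.trans (splitFirst _ _ _)) a then 1 else 0)
        (isometry_relabelling _)
        (useAll r j (swapFirst _ _ _)
          (enc.comp (Channel.ofEquiv (joinFirst r.OutA Keep j)))
          (dec.comp (Channel.ofEquiv (joinFirst r.OutB W j))))

theorem isMonomial_channel_useAll {r : FiniteResource} {fa : r.Rel × r.Abs → r.OutA}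
    {fb : r.Rel × r.Abs → r.OutB} {g : r.Rel × r.Abs → r.Rel × r.Abs → ℂ}
    (hr : r.op.IsMonomial (fun p => (fa p, fb p)) g) :
    ∀ (j : ℕ) {M Keep W : Type} [Fintype M] [DecidableEq M] [Fintype Keep] [DecidableEq Keep]
      [Fintype W] [DecidableEq W] (e : M ≃ (Fin j → r.Rel × r.Abs) × Keep)
      {enc : Channel ((Fin j → r.OutA) × Keep) OA} {dec : Channel ((Fin j → r.OutB) × W) OB}
      {fA : (Fin j → r.OutA) × Keep → OA} {gA : _ → _ → ℂ} (_ : enc.IsMonomial fA gA)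
      {fB : (Fin j → r.OutB) × W → OB} {gB : _ → _ → ℂ} (_ : dec.IsMonomial fB gB),
      (useAll r j e enc dec).channel.IsMonomial
        (fun s => (fA (fun i => fa ((e s.1).1 i), (e s.1).2),
          fB (fun i => fb ((e s.1).1 i), s.2)))
        fun s s' => (∏ i, g ((e s.1).1 i) ((e s'.1).1 i))
          * (gA (fun i => fa ((e s.1).1 i), (e s.1).2) (fun i => fa ((e s'.1).1 i), (e s'.1).2)
            * gB (fun i => fb ((e s.1).1 i), s.2) (fun i => fb ((e s'.1).1 i), s'.2))
  | 0, M, Keep, W, _, _, _, _, _, _, e, enc, dec, fA, gA, henc, fB, gB, hdec => by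
      refine ((henc.comp (Channel.isMonomial_ofEquiv _)).prod
        (hdec.comp (Channel.isMonomial_ofEquiv _))).congr ?_ ?_
      · rintro ⟨m, w⟩
        exact Prod.ext (congrArg fA (Prod.ext (Subsingleton.elim _ _) rfl))
          (congrArg fB (Prod.ext (Subsingleton.elim _ _) rfl))
      · rintro ⟨m, w⟩ ⟨m', w'⟩
        simp only [one_mul, Finset.univ_eq_empty, Finset.prod_empty]
        refine congrArg₂ _ (congrArg₂ gA ?_ ?_) (congrArg₂ gB ?_ ?_) <;>
          exact Prod.ext (Subsingleton.elim _ _) rfl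
  | j + 1, M, Keep, W, _, _, _, _, _, _, e, enc, dec, fA, gA, henc, fB, gB, hdec => by
      have ih := isMonomial_channel_useAll hr j
        (swapFirst r.OutA (Fin j → r.Rel × r.Abs) Keep)
        (henc.comp (Channel.isMonomial_ofEquiv (joinFirst r.OutA Keep j)))
        (hdec.comp (Channel.isMonomial_ofEquiv (joinFirst r.OutB W j)))
      have hcons {X : Type} (h : r.Rel × r.Abs → X) (u : Fin (j + 1) → r.Rel × r.Abs) :
          (Fin.cons (h (u 0)) (fun i => h (u i.succ)) : Fin (j + 1) → X) = fun i => h (u i) := by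
        funext i
        exact Fin.cases rfl (fun _ => rfl) i
      have huse := isMonomial_useStep hr ((Fin j → r.Rel × r.Abs) × Keep) W
      have henc' := isMonomial_encodeStep (W := W) (e.trans (splitFirst (r.Rel × r.Abs) Keep j))
        (isometry_relabelling _)
      refine (ih.comp (huse.comp henc')).congr ?_ ?_
      · rintro ⟨m, w⟩
        simp [swapFirst, splitFirst, joinFirst, hcons]
      · rintro ⟨m, w⟩ ⟨m', w'⟩
        simp [swapFirst, splitFirst, joinFirst, hcons, Fin.prod_univ_succ, mul_assoc]

end Steps

/-- The matrix of the linear functional that reads off the entry `(c, c')` of the restriction of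
a state to the test system of block number `i`. -/
def marginalWeight {R Q Y : Type} [DecidableEq R] [DecidableEq Q] [DecidableEq Y]
    {j : ℕ} (i : Fin j) (c c' : R) (s s' : (Fin j → R × Q) × Y) : ℂ :=
  if (s.1 i).1 = c ∧ (s'.1 i).1 = c' ∧ (s.1 i).2 = (s'.1 i).2 ∧ (∀ q, q ≠ i → s.1 q = s'.1 q)
    ∧ s.2 = s'.2 then 1 else 0

theorem traceSnd_traceSnd_apply {R Q Y : Type} [Fintype R] [DecidableEq R] [Fintype Q]
    [DecidableEq Q] [Fintype Y] [DecidableEq Y]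
    (σ : Matrix ((R × Q) × Y) ((R × Q) × Y) ℂ) (c c' : R) :
    traceSnd (traceSnd σ) c c' = pairing (fun t t' =>
      if t.1.1 = c ∧ t'.1.1 = c' ∧ t.1.2 = t'.1.2 ∧ t.2 = t'.2 then 1 else 0) σ := by
  simp only [traceSnd, Matrix.of_apply, pairing, Fintype.sum_prod_type, ite_and, mul_ite,
    mul_one, mul_zero]
  simp

namespace Steps

variable {OA OB : Type} [Fintype OA] [DecidableEq OA] [Fintype OB] [DecidableEq OB]

theorem valid_useAll {r : FiniteResource} {fa : r.Rel × r.Abs → r.OutA}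
    {fb : r.Rel × r.Abs → r.OutB} {g : r.Rel × r.Abs → r.Rel × r.Abs → ℂ}
    (hr : r.op.IsMonomial (fun p => (fa p, fb p)) g) (hfb : Function.Injective fb)
    (hg : ∀ p, g p p = 1) {η : ℝ} (hη : 0 ≤ η) :
    ∀ (j : ℕ) {M Keep W : Type} [Fintype M] [DecidableEq M] [Fintype Keep] [DecidableEq Keep]
      [Fintype W] [DecidableEq W] (e : M ≃ (Fin j → r.Rel × r.Abs) × Keep)
      (enc : Channel ((Fin j → r.OutA) × Keep) OA) (dec : Channel ((Fin j → r.OutB) × W) OB)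
      (σ : Matrix (M × W) (M × W) ℂ),
      (∀ i c c', pairing (fun s s' => marginalWeight i c c' ((e s.1).1, ((e s.1).2, s.2))
        ((e s'.1).1, ((e s'.1).2, s'.2))) σ = r.test.mat c c') →
      (useAll r j e enc dec).Valid η σ
  | 0, _, _, _, _, _, _, _, _, _, _, _, _, _, _ => True.intro
  | j + 1, M, Keep, W, _, _, _, _, _, _, e, enc, dec, σ, hσ => by
      have huse := isMonomial_useStep hr ((Fin j → r.Rel × r.Abs) × Keep) W
      refine ⟨?_, valid_useAll hr hfb hg hη j _ _ _ _ ?_⟩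
      · refine le_of_eq_of_le ?_ hη
        rw [← traceNorm_zero (A := r.Rel)]
        congr 1
        rw [sub_eq_zero]
        ext c c'
        rw [traceSnd_traceSnd_apply, pairing_apply_of_isMonomial (isMonomial_encodeStep _ _),
          ← hσ 0 c c']
        congr 1
        funext s s'
        rw [one_mul, marginalWeight]
        refine if_congr ?_ rfl rfl
        simp only [splitFirst, Equiv.trans_apply, Equiv.coe_fn_mk, Prod.mk.injEq,
          Fin.forall_fin_succ, funext_iff]
        simp [Fin.succ_ne_zero, and_assoc]
      · intro i c c'
        rw [pairing_apply_of_isMonomial huse,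
          pairing_apply_of_isMonomial (isMonomial_encodeStep _ _), ← hσ i.succ c c']
        congr 1
        funext s s'
        simp only [marginalWeight, splitFirst, swapFirst, Equiv.trans_apply, Equiv.coe_fn_mk,
          Prod.mk.injEq, Fin.forall_fin_succ, hfb.eq_iff, one_mul, mul_ite, mul_one, mul_zero]
        by_cases h0 : (e s.1).1 0 = (e s'.1).1 0
        · simp [h0, hg, (Fin.succ_ne_zero i).symm]
        · simp [h0, (Fin.succ_ne_zero i).symm]

end Steps

/-! ### Exact simulation -/

theorem DepthResource.times_singleton (k : ℕ) (r : FiniteResource) :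
    DepthResource.times k [r] = List.replicate k r := by
  simp [DepthResource.times]

/-- A criterion for `k` copies of `r` to simulate `t` exactly, when all operations involved are
monomial, except that Alice's initial operation may use a random key. -/
theorem exists_protocol {r t : FiniteResource} {k : ℕ} {Keep K : Type} [Fintype Keep]
    [DecidableEq Keep] [Fintype K]
    {fa : r.Rel × r.Abs → r.OutA} {fb : r.Rel × r.Abs → r.OutB}
    {g : r.Rel × r.Abs → r.Rel × r.Abs → ℂ}
    (hr : r.op.IsMonomial (fun p => (fa p, fb p)) g) (hfb : Function.Injective fb)
    (hg : ∀ p, g p p = 1)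
    {ft : t.Rel × t.Abs → t.OutA × t.OutB} {gt : t.Rel × t.Abs → t.Rel × t.Abs → ℂ}
    (ht : t.op.IsMonomial ft gt)
    {init : Channel (t.Rel × t.Abs) ((Fin k → r.Rel × r.Abs) × Keep)}
    {u : K → t.Rel × t.Abs → (Fin k → r.Rel × r.Abs) × Keep}
    {w : K → t.Rel × t.Abs → t.Rel × t.Abs → ℂ} (hinit : init.IsMixture u w)
    {enc : Channel ((Fin k → r.OutA) × Keep) t.OutA} {fA : _ → t.OutA} {gA : _ → _ → ℂ}
    (henc : enc.IsMonomial fA gA)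
    {dec : Channel (Fin k → r.OutB) t.OutB} {fB : _ → t.OutB} {gB : _ → _ → ℂ}
    (hdec : dec.IsMonomial fB gB)
    (hvalid : ∀ i c c' a a', ∑ κ, w κ a a' * marginalWeight i c c' (u κ a) (u κ a')
      = if a = a' then r.test.mat c c' else 0)
    (hmap : ∀ κ a, (fA (fun i => fa ((u κ a).1 i), (u κ a).2),
      fB fun i => fb ((u κ a).1 i)) = ft a)
    (hweight : ∀ a a', ∑ κ, w κ a a' * ((∏ i, g ((u κ a).1 i) ((u κ a').1 i))
      * (gA (fun i => fa ((u κ a).1 i), (u κ a).2) (fun i => fa ((u κ a').1 i), (u κ a').2)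
        * gB (fun i => fb ((u κ a).1 i)) fun i => fb ((u κ a').1 i))) = gt a a')
    {ε : ℝ} (hε : 0 ≤ ε) :
    ∃ P : Protocol (DepthResource.times k [r]) (t.Rel × t.Abs) t.OutA t.OutB,
      P.Valid t.test ε ∧ relDist P.channel t.op t.test ≤ ENNReal.ofReal ε := by
  have hdec' := hdec.comp (Channel.isMonomial_ofEquiv (Equiv.prodPUnit (Fin k → r.OutB)))
  let P : Protocol (DepthResource.times k [r]) (t.Rel × t.Abs) t.OutA t.OutB :=
    { order := List.replicate k r
      perm := by rw [DepthResource.times_singleton]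
      Mem := (Fin k → r.Rel × r.Abs) × Keep
      init := init
      steps := Steps.useAll r k (Equiv.refl _) enc
        (dec.comp (Channel.ofEquiv (Equiv.prodPUnit (Fin k → r.OutB)))) }
  have hstart : P.start.IsMixture (fun κ a => (u κ a, ())) fun κ a a' => w κ a a' * 1 :=
    Channel.IsMixture.comp
      (Channel.isMonomial_ofEquiv (Equiv.prodPUnit ((Fin k → r.Rel × r.Abs) × Keep)).symm) hinit
  refine ⟨P, ?_, ?_⟩
  · intro R _ ξ _
    refine Steps.valid_useAll hr hfb hg hε k _ _ _ _ fun i c c' => ?_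
    have h1 : (traceFst ξ.mat).trace = 1 := by rw [trace_traceFst, ξ.trace_eq_one]
    rw [pairing_apply_of_isMixture hstart]
    have := pairing_diagonal (r.test.mat c c') (traceFst ξ.mat)
    rw [h1, one_mul] at this
    rw [← this]
    congr 1
    funext a a'
    rw [← hvalid i c c' a a']
    refine Finset.sum_congr rfl fun κ _ => ?_
    simp only [mul_one, marginalWeight, Prod.mk.injEq, and_true]
    rfl
  · refine (le_of_eq (relDist_eq_zero _ ?_)).trans zero_le
    funext o o' a a'
    have h := Channel.IsMixture.comp
      (Steps.isMonomial_channel_useAll hr k (Equiv.refl _) henc hdec') hstart o o' a a'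
    simp only [mul_one, one_mul, Equiv.refl_apply, Equiv.prodPUnit_apply, hmap] at h
    refine h.trans ?_
    rw [ht, ← hweight]
    split_ifs
    · rfl
    · simp

/-! ### Covariant bit channels -/

/-- The operation `N` hands the basis label of its input bit to Bob and a function `h` of it to
Alice, and is covariant under bit flips of the input. -/
structure IsFlipCovariant {C : Type} [Fintype C] [DecidableEq C]
    (N : Channel (Fin 2) (C × Fin 2)) (h : Fin 2 → C) (g : Fin 2 → Fin 2 → ℂ)
    (act : Fin 2 → C → C) : Prop where
  isMonomial : N.IsMonomial (fun a => (h a, a)) g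
  weight_self : ∀ a, g a a = 1
  weight_add : ∀ a a' x, g (a + x) (a' + x) = g a a'
  act_apply : ∀ x a, act x (h (a + x)) = h a
  act_injective : ∀ x, Function.Injective (act x)

theorem isFlipCovariant_idChannel :
    IsFlipCovariant (idChannel 2) (fun _ => ()) (fun _ _ => 1) fun _ c => c where
  isMonomial := by
    rintro ⟨_, b⟩ ⟨_, b'⟩ a a'
    rw [idChannel, Channel.kernel_ofIsometry]
    by_cases h₁ : b = a <;> by_cases h₂ : b' = a' <;> simp [h₁, h₂]
  weight_self _ := rfl
  weight_add _ _ _ := rfl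
  act_apply _ _ := rfl
  act_injective _ _ _ h := h

theorem isFlipCovariant_coherentChannel :
    IsFlipCovariant (coherentChannel 2) (fun a => a) (fun _ _ => 1) fun x c => c + x where
  isMonomial := by
    rintro ⟨c, b⟩ ⟨c', b'⟩ a a'
    rw [coherentChannel, Channel.kernel_ofIsometry]
    by_cases h₁ : c = a ∧ b = a <;> by_cases h₂ : c' = a' ∧ b' = a' <;> simp [h₁, h₂]
  weight_self _ := rfl
  weight_add _ _ _ := rfl
  act_apply := by decide
  act_injective x _ _ h := add_right_cancel h

theorem isFlipCovariant_classicalChannel :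
    IsFlipCovariant (classicalChannel 2) (fun _ => ()) (fun a a' => if a = a' then 1 else 0)
      fun _ c => c where
  isMonomial := by
    rintro ⟨_, b⟩ ⟨_, b'⟩ a a'
    change ∑ y : Fin 2, (if b = y ∧ a = y then (1 : ℂ) else 0)
      * star (if b' = y ∧ a' = y then (1 : ℂ) else 0) = _
    revert b b' a a'
    simp [Fin.forall_fin_two]
  weight_self _ := if_pos rfl
  weight_add a a' x := by simp
  act_apply _ _ := rfl
  act_injective _ _ _ h := h

section

variable {C : Type} [Fintype C] [DecidableEq C] {N : Channel (Fin 2) (C × Fin 2)}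
  {h : Fin 2 → C} {g : Fin 2 → Fin 2 → ℂ} {act : Fin 2 → C → C}

theorem IsFlipCovariant.proper_pow (hN : IsFlipCovariant N h g act) (n : ℕ) :
    ((FiniteResource.proper N).pow n).op.IsMonomial
      (fun p => (fun i => h (p.2 i), fun i => p.2 i)) fun p p' => ∏ i, g (p.2 i) (p'.2 i) :=
  ((hN.isMonomial.comp (Channel.isMonomial_ofEquiv (Equiv.punitProd (Fin 2)))).pow n).congr
    (fun _ => rfl) fun p p' => by simp only [one_mul]; rfl

theorem IsFlipCovariant.relative_pow (hN : IsFlipCovariant N h g act) (ω : State (Fin 2))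
    (n : ℕ) :
    ((FiniteResource.relative N ω).pow n).op.IsMonomial
      (fun p => (fun i => h (p.1 i), fun i => p.1 i)) fun p p' => ∏ i, g (p.1 i) (p'.1 i) :=
  ((hN.isMonomial.comp (Channel.isMonomial_ofEquiv (Equiv.prodPUnit (Fin 2)))).pow n).congr
    (fun _ => rfl) fun p p' => by simp only [one_mul]; rfl

end

/-! ### Discarding the unused sites -/

section Discard

variable {m k b : ℕ} {X : Type}

open Classical in
/-- The content of the sites outside the range of `ι`. -/
def discard (ι : Fin m → Fin k × Fin b) (o : Fin k → Fin b → X) : Fin k × Fin b → Option X :=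
  fun p => if p ∈ Set.range ι then none else some (o p.1 p.2)

theorem discard_eq_iff {ι : Fin m → Fin k × Fin b} {o o' : Fin k → Fin b → X} :
    discard ι o = discard ι o' ↔ ∀ p, p ∉ Set.range ι → o p.1 p.2 = o' p.1 p.2 := by
  constructor
  · intro h p hp
    have := congrFun h p
    simpa only [discard, if_neg hp, Option.some.injEq] using this
  · intro h
    funext p
    by_cases hp : p ∈ Set.range ι
    · simp only [discard, if_pos hp]
    · simp only [discard, if_neg hp, h p hp]

theorem eq_of_discard_eq {ι : Fin m → Fin k × Fin b} {o o' : Fin k → Fin b → X}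
    (h : discard ι o = discard ι o') (h' : ∀ t, o (ι t).1 (ι t).2 = o' (ι t).1 (ι t).2) :
    o = o' := by
  funext q l
  by_cases hp : (q, l) ∈ Set.range ι
  · obtain ⟨t, ht⟩ := hp
    have := h' t
    rwa [ht] at this
  · exact discard_eq_iff.mp h (q, l) hp

theorem prod_weight {g : X → X → ℂ} (hg : ∀ a, g a a = 1) {ι : Fin m → Fin k × Fin b}
    (hι : Function.Injective ι) (v v' : Fin k → Fin b → X)
    (hoff : ∀ p, p ∉ Set.range ι → v p.1 p.2 = v' p.1 p.2) (a a' : Fin m → X)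
    (hon : ∀ t, g (v (ι t).1 (ι t).2) (v' (ι t).1 (ι t).2) = g (a t) (a' t)) :
    ∏ q, ∏ l, g (v q l) (v' q l) = ∏ t, g (a t) (a' t) := by
  rw [← Fintype.prod_prod_type' fun q l => g (v q l) (v' q l)]
  refine (Fintype.prod_of_injective ι hι _ _ (fun p hp => ?_) fun t => (hon t).symm).symm
  rw [hoff p hp, hg]

end Discard

/-! ### Proper resources simulate relative ones -/

theorem exists_protocol_relative_of_proper {C : Type} [Fintype C] [DecidableEq C]
    {N : Channel (Fin 2) (C × Fin 2)} {h : Fin 2 → C} {g : Fin 2 → Fin 2 → ℂ}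
    {act : Fin 2 → C → C} (hN : IsFlipCovariant N h g act) (ω : State (Fin 2)) {m n : ℕ}
    (hmn : m ≤ n) {ε : ℝ} (hε : 0 ≤ ε) :
    let t := (FiniteResource.relative N ω).pow m
    ∃ P : Protocol (DepthResource.times 1 [(FiniteResource.proper N).pow n])
        (t.Rel × t.Abs) t.OutA t.OutB,
      P.Valid t.test ε ∧ relDist P.channel t.op t.test ≤ ENNReal.ofReal ε := by
  intro t
  let ι : Fin m → Fin 1 × Fin n := fun i => (0, Fin.castLE hmn i)
  have hι : Function.Injective ι := fun i i' hi =>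
    Fin.castLE_injective hmn (congrArg Prod.snd hi)
  let u : Unit → (Fin m → Fin 2) × (Fin m → Unit) →
      (Fin 1 → (Fin n → Unit) × (Fin n → Fin 2)) × Unit :=
    fun _ a => (fun q => (fun _ => (), fun l => Function.extend ι a.1 0 (q, l)), ())
  have hu_on (a t') : ((u () a).1 (ι t').1).2 (ι t').2 = a.1 t' := hι.extend_apply _ _ _
  have hu_off (a p) (hp : p ∉ Set.range ι) : ((u () a).1 p.1).2 p.2 = 0 :=
    Function.extend_apply' _ _ _ hp
  have hu : Function.Injective (u ()) := fun a a' ha => by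
    refine Prod.ext (funext fun t' => ?_) (Subsingleton.elim _ _)
    rw [← hu_on a t', ha, hu_on]
  obtain ⟨init, hinit⟩ := Channel.exists_isMixture u (fun _ _ => 1) (fun _ => hu) (by simp)
  obtain ⟨enc, henc⟩ := Channel.exists_isMonomial
    (fun (o : (Fin 1 → Fin n → C) × Unit) (t' : Fin m) => o.1 (ι t').1 (ι t').2)
    (fun o => discard ι o.1) (fun _ => 1)
    (fun o o' ho => Prod.ext (eq_of_discard_eq (congrArg Prod.snd ho)
      (congrFun (congrArg Prod.fst ho))) rfl) (by simp)
  obtain ⟨dec, hdec⟩ := Channel.exists_isMonomial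
    (fun (o : Fin 1 → Fin n → Fin 2) (t' : Fin m) => o (ι t').1 (ι t').2)
    (fun o => discard ι o) (fun _ => 1)
    (fun o o' ho => eq_of_discard_eq (congrArg Prod.snd ho)
      (congrFun (congrArg Prod.fst ho))) (by simp)
  have hvalid (i : Fin 1) (c c' : Fin n → Unit) (a a' : (Fin m → Fin 2) × (Fin m → Unit)) :
      ∑ κ : Unit, (Fintype.card Unit : ℂ)⁻¹ * (1 * star 1)
        * marginalWeight i c c' (u κ a) (u κ a')
        = if a = a' then ∏ l, (1 : Matrix Unit Unit ℂ) (c l) (c' l) else 0 := by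
    rw [Fintype.sum_unique, Finset.prod_eq_one fun l _ => Matrix.one_apply_eq (c l)]
    by_cases ha : a = a'
    · subst ha
      rw [if_pos rfl, marginalWeight, if_pos]
      · simp
      · exact ⟨rfl, rfl, rfl, fun _ _ => rfl, rfl⟩
    · rw [if_neg ha, marginalWeight, if_neg, mul_zero]
      rintro ⟨-, -, hi, -, -⟩
      refine ha (hu (Prod.ext (funext fun q => ?_) rfl))
      rw [Subsingleton.elim q i]
      exact Prod.ext rfl hi
  have hweight (a a' : (Fin m → Fin 2) × (Fin m → Unit)) :
      ∑ κ : Unit, (Fintype.card Unit : ℂ)⁻¹ * (1 * star 1)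
        * ((∏ q, ∏ l, g (((u κ a).1 q).2 l) (((u κ a').1 q).2 l))
          * ((if discard ι (fun q l => h (((u κ a).1 q).2 l))
              = discard ι (fun q l => h (((u κ a').1 q).2 l)) then 1 * star 1 else 0)
            * (if discard ι (fun q l => ((u κ a).1 q).2 l)
              = discard ι (fun q l => ((u κ a').1 q).2 l) then 1 * star 1 else 0)))
        = ∏ t', g (a.1 t') (a'.1 t') := by
    have hoff (p) (hp : p ∉ Set.range ι) :
        ((u () a).1 p.1).2 p.2 = ((u () a').1 p.1).2 p.2 := by rw [hu_off _ _ hp, hu_off _ _ hp]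
    have hprod := prod_weight hN.weight_self hι (fun q => ((u () a).1 q).2)
      (fun q => ((u () a').1 q).2) hoff a.1 a'.1 fun t' => by rw [hu_on, hu_on]
    rw [Fintype.sum_unique, if_pos, if_pos, ← hprod]
    · simp
    · exact discard_eq_iff.mpr hoff
    · exact discard_eq_iff.mpr fun p hp => congrArg h (hoff p hp)
  refine exists_protocol (hN.proper_pow n) ?_ ?_ (hN.relative_pow ω m) hinit henc hdec
    hvalid (fun κ a => ?_) hweight hε
  · intro p p' hp
    exact Prod.ext (funext fun _ => rfl) hp
  · intro p
    exact Finset.prod_eq_one fun i _ => hN.weight_self _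
  · refine Prod.ext (funext fun t' => ?_) (funext fun t' => ?_)
    · exact congrArg h (hu_on a t')
    · exact hu_on a t'

/-! ### Twirling with a shared key -/

/-- The sign `(-1) ^ (z a)`. -/
def bitSign (z a : Fin 2) : ℂ := if z = 1 ∧ a = 1 then -1 else 1

theorem bitSign_mul_self (z a : Fin 2) : bitSign z a * bitSign z a = 1 := by
  unfold bitSign
  split_ifs <;> norm_num

theorem star_bitSign (z a : Fin 2) : star (bitSign z a) = bitSign z a := by
  unfold bitSign
  split_ifs <;> simp

theorem bitSign_add_one_mul {a a' : Fin 2} (h : a ≠ a') (z : Fin 2) :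
    bitSign (z + 1) a * bitSign (z + 1) a' = -(bitSign z a * bitSign z a') := by
  revert z a a'
  simp [bitSign, Fin.forall_fin_two]

section Twirl

variable {m k b : ℕ}

/-- The sign acquired by the basis label `a` when the key `z` controls phase flips. -/
def keySign (ι : Fin m → Fin k × Fin b) (z : Fin b → Fin 2) (a : Fin m → Fin 2) : ℂ :=
  ∏ t, bitSign (z (ι t).2) (a t)

theorem keySign_mul_self (ι : Fin m → Fin k × Fin b) (z : Fin b → Fin 2) (a : Fin m → Fin 2) :
    keySign ι z a * keySign ι z a = 1 := by
  simp only [keySign, ← Finset.prod_mul_distrib, bitSign_mul_self, Finset.prod_const_one]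

theorem star_keySign (ι : Fin m → Fin k × Fin b) (z : Fin b → Fin 2) (a : Fin m → Fin 2) :
    star (keySign ι z a) = keySign ι z a := by
  simp only [keySign, star_prod, star_bitSign]

/-- Random phase flips remove the coherence between labels that differ in one block only, even
if the same key is used for all blocks. -/
theorem sum_keySign_mul {ι : Fin m → Fin k × Fin b} (hι : Function.Injective ι) {i : Fin k}
    {a a' : Fin m → Fin 2} (ha : a ≠ a') (hoff : ∀ t, (ι t).1 ≠ i → a t = a' t) :
    ∑ z, keySign ι z a * keySign ι z a' = 0 := by
  obtain ⟨s, hs⟩ := Function.ne_iff.mp ha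
  have hi : ∀ t, a t ≠ a' t → (ι t).1 = i := fun t ht => by
    by_contra hc
    exact ht (hoff t hc)
  have hflip (z : Fin b → Fin 2) :
      keySign ι (z + Pi.single (ι s).2 1) a * keySign ι (z + Pi.single (ι s).2 1) a'
        = -(keySign ι z a * keySign ι z a') := by
    simp only [keySign, ← Finset.prod_mul_distrib]
    rw [← Finset.mul_prod_erase _ _ (Finset.mem_univ s),
      ← Finset.mul_prod_erase _ (fun t => bitSign (z (ι t).2) (a t) * bitSign (z (ι t).2) (a' t))
        (Finset.mem_univ s), ← neg_mul]
    congr 1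
    · rw [Pi.add_apply, Pi.single_eq_same, bitSign_add_one_mul hs]
    · refine Finset.prod_congr rfl fun t ht => ?_
      by_cases hl : (ι t).2 = (ι s).2
      · have hat : a t = a' t := by
          by_contra hc
          exact Finset.ne_of_mem_erase ht (hι (Prod.ext ((hi t hc).trans (hi s hs).symm) hl))
        rw [hat, bitSign_mul_self, bitSign_mul_self]
      · rw [Pi.add_apply, Pi.single_eq_of_ne hl, add_zero]
  have hsum := Equiv.sum_comp (Equiv.addRight (Pi.single (ι s).2 (1 : Fin 2)))
    fun z => keySign ι z a * keySign ι z a'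
  simp only [Equiv.coe_addRight, hflip, Finset.sum_neg_distrib] at hsum
  exact self_eq_neg.mp hsum.symm

/-- The contents of the blocks sent by Alice: the keys `x` and `z`, followed by the data, flipped
according to the key `x`. -/
def keyedBlocks {j : ℕ} (ι : Fin m → Fin (j + 2) × Fin b)
    (κ : (Fin b → Fin 2) × (Fin b → Fin 2)) (a : Fin m → Fin 2) : Fin (j + 2) → Fin b → Fin 2 :=
  fun q => if q = 0 then κ.1 else if q = 1 then κ.2 else
    fun l => Function.extend ι a 0 (q, l) + κ.1 l

variable {j : ℕ} {ι : Fin m → Fin (j + 2) × Fin b}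

theorem keyedBlocks_zero (κ : (Fin b → Fin 2) × (Fin b → Fin 2)) (a : Fin m → Fin 2) :
    keyedBlocks ι κ a 0 = κ.1 := by
  simp [keyedBlocks]

theorem keyedBlocks_one (κ : (Fin b → Fin 2) × (Fin b → Fin 2)) (a : Fin m → Fin 2) :
    keyedBlocks ι κ a 1 = κ.2 := by
  simp [keyedBlocks]

theorem keyedBlocks_on (hι : Function.Injective ι) (h0 : ∀ t, (ι t).1 ≠ 0)
    (h1 : ∀ t, (ι t).1 ≠ 1) (κ : (Fin b → Fin 2) × (Fin b → Fin 2)) (a : Fin m → Fin 2)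
    (t : Fin m) : keyedBlocks ι κ a (ι t).1 (ι t).2 = a t + κ.1 (ι t).2 := by
  simp [keyedBlocks, h0, h1, hι.extend_apply]

theorem keyedBlocks_off (κ : (Fin b → Fin 2) × (Fin b → Fin 2)) (a a' : Fin m → Fin 2)
    {p : Fin (j + 2) × Fin b} (hp : p ∉ Set.range ι) :
    keyedBlocks ι κ a p.1 p.2 = keyedBlocks ι κ a' p.1 p.2 := by
  have h (a : Fin m → Fin 2) : Function.extend ι a 0 (p.1, p.2) = 0 :=
    Function.extend_apply' _ _ _ hp
  simp only [keyedBlocks]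
  split_ifs <;> simp [h]

/-- The number of keys for which a block has a given content. -/
theorem sum_ite_keyedBlocks (a : Fin m → Fin 2) (i : Fin (j + 2)) (c : Fin b → Fin 2) :
    (∑ κ, if keyedBlocks ι κ a i = c then (1 : ℂ) else 0) = 2 ^ b := by
  by_cases hi0 : i = 0
  · subst hi0
    simp only [keyedBlocks_zero]
    rw [Fintype.sum_prod_type_right]
    simp
  by_cases hi1 : i = 1
  · subst hi1
    simp only [keyedBlocks_one]
    rw [Fintype.sum_prod_type]
    simp
  · have h (κ : (Fin b → Fin 2) × (Fin b → Fin 2)) : keyedBlocks ι κ a i = c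
        ↔ κ.1 = c - fun l => Function.extend ι a 0 (i, l) := by
      rw [eq_sub_iff_add_eq, add_comm]
      simp only [keyedBlocks, hi0, hi1, if_false]
      rfl
    simp only [h]
    rw [Fintype.sum_prod_type_right]
    simp

/-- With a uniformly random key every block is maximally mixed. -/
theorem sum_keySign_marginal (hι : Function.Injective ι) (h0 : ∀ t, (ι t).1 ≠ 0)
    (h1 : ∀ t, (ι t).1 ≠ 1) (i : Fin (j + 2)) (c c' : Fin b → Fin 2) (a a' : Fin m → Fin 2) :
    (∑ κ : (Fin b → Fin 2) × (Fin b → Fin 2), keySign ι κ.2 a * keySign ι κ.2 a'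
      * if keyedBlocks ι κ a i = c ∧ keyedBlocks ι κ a' i = c'
        ∧ ∀ q, q ≠ i → keyedBlocks ι κ a q = keyedBlocks ι κ a' q then 1 else 0)
      = if a = a' ∧ c = c' then 2 ^ b else 0 := by
  by_cases ha : a = a'
  · subst ha
    simp only [keySign_mul_self, one_mul, true_and, implies_true, and_true]
    by_cases hc : c = c'
    · subst hc
      simp only [and_self, if_true, sum_ite_keyedBlocks]
    · rw [if_neg hc]
      exact Finset.sum_eq_zero fun κ _ => if_neg fun hh => hc (hh.1.symm.trans hh.2)
  · rw [if_neg fun hh => ha hh.1]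
    by_cases hoff : ∀ t, (ι t).1 ≠ i → a t = a' t
    · have hq (κ κ' : (Fin b → Fin 2) × (Fin b → Fin 2)) (hκ : κ.1 = κ'.1) (q) (hq : q ≠ 1) (a) :
          keyedBlocks ι κ a q = keyedBlocks ι κ' a q := by
        simp only [keyedBlocks, hκ, hq, if_false]
      have hi (s) (hs : a s ≠ a' s) : (ι s).1 = i := by
        by_contra hc
        exact hs (hoff s hc)
      obtain ⟨s, hs⟩ := Function.ne_iff.mp ha
      have hi1 : i ≠ 1 := hi s hs ▸ h1 s
      have hP (x z : Fin b → Fin 2) : (keyedBlocks ι (x, z) a i = c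
          ∧ keyedBlocks ι (x, z) a' i = c'
          ∧ ∀ q, q ≠ i → keyedBlocks ι (x, z) a q = keyedBlocks ι (x, z) a' q)
          ↔ (keyedBlocks ι (x, 0) a i = c ∧ keyedBlocks ι (x, 0) a' i = c'
          ∧ ∀ q, q ≠ i → keyedBlocks ι (x, 0) a q = keyedBlocks ι (x, 0) a' q) := by
        rw [hq (x, z) (x, 0) rfl i hi1, hq (x, z) (x, 0) rfl i hi1]
        refine and_congr Iff.rfl (and_congr Iff.rfl (forall_congr' fun q => ?_))
        by_cases hq1 : q = 1
        · subst hq1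
          simp [keyedBlocks_one]
        · rw [hq (x, z) (x, 0) rfl q hq1, hq (x, z) (x, 0) rfl q hq1]
      rw [Fintype.sum_prod_type]
      refine Finset.sum_eq_zero fun x _ => ?_
      simp only [hP, ← Finset.sum_mul, sum_keySign_mul hι ha hoff, zero_mul]
    · push Not at hoff
      obtain ⟨t, ht, hat⟩ := hoff
      refine Finset.sum_eq_zero fun κ _ => ?_
      rw [if_neg, mul_zero]
      rintro ⟨-, -, hh⟩
      have := congrFun (hh _ ht) (ι t).2
      rw [keyedBlocks_on hι h0 h1, keyedBlocks_on hι h0 h1] at this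
      exact hat (add_right_cancel this)

end Twirl

/-! ### Relative resources simulate proper ones -/

theorem exists_protocol_proper_of_relative {C : Type} [Fintype C] [DecidableEq C]
    {N : Channel (Fin 2) (C × Fin 2)} {h : Fin 2 → C} {g : Fin 2 → Fin 2 → ℂ}
    {act : Fin 2 → C → C} (hN : IsFlipCovariant N h g act) {m j b : ℕ}
    (hm : m ≤ j * b) {ε : ℝ} (hε : 0 ≤ ε) :
    let t := (FiniteResource.proper N).pow m
    ∃ P : Protocol (DepthResource.times (j + 2)
        [(FiniteResource.relative N (State.maximallyMixed (Fin 2))).pow b])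
        (t.Rel × t.Abs) t.OutA t.OutB,
      P.Valid t.test ε ∧ relDist P.channel t.op t.test ≤ ENNReal.ofReal ε := by
  intro t
  let ι : Fin m → Fin (j + 2) × Fin b := fun s =>
    ((finProdFinEquiv.symm (Fin.castLE hm s)).1.succ.succ,
      (finProdFinEquiv.symm (Fin.castLE hm s)).2)
  have hι : Function.Injective ι := fun s s' hs => by
    refine Fin.castLE_injective hm (finProdFinEquiv.symm.injective (Prod.ext ?_ ?_))
    · exact Fin.succ_injective _ (Fin.succ_injective _ (congrArg Prod.fst hs))
    · exact congrArg (fun y => y.2) hs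
  have h0 (s) : (ι s).1 ≠ 0 :=
    Fin.succ_ne_zero (finProdFinEquiv.symm (Fin.castLE hm s)).1.succ
  have h1 (s) : (ι s).1 ≠ 1 := fun hc =>
    Fin.succ_ne_zero (finProdFinEquiv.symm (Fin.castLE hm s)).1 (Fin.succ_injective _ hc)
  have h0' (l : Fin b) : ((0, l) : Fin (j + 2) × Fin b) ∉ Set.range ι := by
    rintro ⟨s, hs⟩
    exact h0 s (congrArg Prod.fst hs)
  have hadd : ∀ a x : Fin 2, a + x + x = a := by decide
  let K := (Fin b → Fin 2) × (Fin b → Fin 2)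
  let u : K → (Fin m → Unit) × (Fin m → Fin 2) →
      (Fin (j + 2) → (Fin b → Fin 2) × (Fin b → Unit)) × K :=
    fun κ a => (fun q => (keyedBlocks ι κ a.2 q, fun _ => ()), κ)
  have hu (κ) : Function.Injective (u κ) := fun a a' ha => by
    refine Prod.ext (Subsingleton.elim _ _) (funext fun s => ?_)
    have hs : keyedBlocks ι κ a.2 (ι s).1 (ι s).2 = keyedBlocks ι κ a'.2 (ι s).1 (ι s).2 :=
      congrArg (fun y => (y.1 (ι s).1).1 (ι s).2) ha
    rw [keyedBlocks_on hι h0 h1, keyedBlocks_on hι h0 h1] at hs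
    exact add_right_cancel hs
  have hsign (κ : K) (a : Fin m → Fin 2) : star (keySign ι κ.2 a) * keySign ι κ.2 a = 1 := by
    rw [star_keySign, keySign_mul_self]
  obtain ⟨init, hinit⟩ := Channel.exists_isMixture u (fun κ a => keySign ι κ.2 a.2) hu
    fun κ a => hsign κ a.2
  obtain ⟨enc, henc⟩ := Channel.exists_isMonomial
    (fun (o : (Fin (j + 2) → Fin b → C) × K) (s : Fin m) =>
      act (o.2.1 (ι s).2) (o.1 (ι s).1 (ι s).2))
    (fun o => (discard ι o.1, o.2)) (fun _ => 1)
    (fun o o' ho => by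
      have hK : o.2 = o'.2 := congrArg (fun y => y.2.2) ho
      refine Prod.ext (eq_of_discard_eq (congrArg (fun y => y.2.1) ho) fun s => ?_) hK
      have hs := congrFun (congrArg Prod.fst ho) s
      simp only [hK] at hs
      exact hN.act_injective _ hs) (by simp)
  let fB : (Fin (j + 2) → Fin b → Fin 2) → Fin m → Fin 2 :=
    fun o s => o (ι s).1 (ι s).2 + o 0 (ι s).2
  obtain ⟨dec, hdec⟩ := Channel.exists_isMonomial fB
    (fun o => discard ι o) (fun o => keySign ι (o 1) (fB o))
    (fun o o' ho => by
      have hd : discard ι o = discard ι o' := congrArg Prod.snd ho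
      refine eq_of_discard_eq hd fun s => ?_
      have hs : o (ι s).1 (ι s).2 + o 0 (ι s).2 = o' (ι s).1 (ι s).2 + o' 0 (ι s).2 :=
        congrFun (congrArg Prod.fst ho) s
      rw [discard_eq_iff.mp hd _ (h0' (ι s).2)] at hs
      exact add_right_cancel hs)
    (fun o => by rw [star_keySign, keySign_mul_self])
  have hfB (κ : K) (a : Fin m → Fin 2) : fB (keyedBlocks ι κ a) = a := by
    funext s
    simp only [fB, keyedBlocks_on hι h0 h1, keyedBlocks_zero, hadd]
  have hcard : (Fintype.card K : ℂ) = 2 ^ b * 2 ^ b := by simp [K]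
  have hvalid (i : Fin (j + 2)) (c c' : Fin b → Fin 2)
      (a a' : (Fin m → Unit) × (Fin m → Fin 2)) :
      ∑ κ : K, (Fintype.card K : ℂ)⁻¹ * (keySign ι κ.2 a.2 * star (keySign ι κ.2 a'.2))
        * marginalWeight i c c' (u κ a) (u κ a')
        = if a = a' then ∏ l, (((Fintype.card (Fin 2) : ℂ)⁻¹ • 1 : Matrix (Fin 2) (Fin 2) ℂ))
          (c l) (c' l) else 0 := by
    have hmarg (κ : K) : marginalWeight i c c' (u κ a) (u κ a')
        = if keyedBlocks ι κ a.2 i = c ∧ keyedBlocks ι κ a'.2 i = c'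
          ∧ ∀ q, q ≠ i → keyedBlocks ι κ a.2 q = keyedBlocks ι κ a'.2 q then 1 else 0 := by
      rw [marginalWeight]
      refine if_congr ?_ rfl rfl
      simp [u]
    have hmixed : ∏ l, (((Fintype.card (Fin 2) : ℂ)⁻¹ • 1 : Matrix (Fin 2) (Fin 2) ℂ))
        (c l) (c' l) = if c = c' then (2 ^ b)⁻¹ else 0 := by
      by_cases hc : c = c'
      · subst hc
        simp
      · obtain ⟨l, hl⟩ := Function.ne_iff.mp hc
        rw [if_neg hc]
        exact Finset.prod_eq_zero (Finset.mem_univ l) (by simp [hl])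
    have haa : a = a' ↔ a.2 = a'.2 :=
      ⟨congrArg Prod.snd, fun ha => Prod.ext (Subsingleton.elim _ _) ha⟩
    simp only [mul_assoc, ← Finset.mul_sum]
    simp only [← mul_assoc, star_keySign, hmarg]
    rw [sum_keySign_marginal hι h0 h1, hmixed, hcard]
    by_cases ha : a = a'
    · by_cases hc : c = c'
      · simp [ha, hc]
      · simp [hc]
    · rw [if_neg fun hh => ha (haa.mpr hh.1), if_neg ha, mul_zero]
  have hweight (a a' : (Fin m → Unit) × (Fin m → Fin 2)) :
      ∑ κ : K, (Fintype.card K : ℂ)⁻¹ * (keySign ι κ.2 a.2 * star (keySign ι κ.2 a'.2))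
        * ((∏ q, ∏ l, g (keyedBlocks ι κ a.2 q l) (keyedBlocks ι κ a'.2 q l))
          * ((if (discard ι (fun q l => h (keyedBlocks ι κ a.2 q l)), κ)
              = (discard ι (fun q l => h (keyedBlocks ι κ a'.2 q l)), κ) then 1 * star 1 else 0)
            * (if discard ι (keyedBlocks ι κ a.2) = discard ι (keyedBlocks ι κ a'.2) then
              keySign ι (keyedBlocks ι κ a.2 1) (fB (keyedBlocks ι κ a.2))
                * star (keySign ι (keyedBlocks ι κ a'.2 1) (fB (keyedBlocks ι κ a'.2)))
              else 0)))
        = ∏ s, g (a.2 s) (a'.2 s) := by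
    have hterm (κ : K) : (Fintype.card K : ℂ)⁻¹
        * (keySign ι κ.2 a.2 * star (keySign ι κ.2 a'.2))
        * ((∏ q, ∏ l, g (keyedBlocks ι κ a.2 q l) (keyedBlocks ι κ a'.2 q l))
          * ((if (discard ι (fun q l => h (keyedBlocks ι κ a.2 q l)), κ)
              = (discard ι (fun q l => h (keyedBlocks ι κ a'.2 q l)), κ) then 1 * star 1 else 0)
            * (if discard ι (keyedBlocks ι κ a.2) = discard ι (keyedBlocks ι κ a'.2) then
              keySign ι (keyedBlocks ι κ a.2 1) (fB (keyedBlocks ι κ a.2))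
                * star (keySign ι (keyedBlocks ι κ a'.2 1) (fB (keyedBlocks ι κ a'.2)))
              else 0)))
        = (Fintype.card K : ℂ)⁻¹ * ∏ s, g (a.2 s) (a'.2 s) := by
      rw [prod_weight hN.weight_self hι _ _ (fun p hp => keyedBlocks_off κ a.2 a'.2 hp) a.2 a'.2
        fun s => by rw [keyedBlocks_on hι h0 h1, keyedBlocks_on hι h0 h1, hN.weight_add]]
      rw [if_pos, if_pos, hfB, hfB, keyedBlocks_one, keyedBlocks_one, star_keySign, star_one,
        mul_one, one_mul]
      · linear_combination ((Fintype.card K : ℂ)⁻¹ * (∏ s, g (a.2 s) (a'.2 s))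
          * (keySign ι κ.2 a'.2 * keySign ι κ.2 a'.2)) * keySign_mul_self ι κ.2 a.2
          + ((Fintype.card K : ℂ)⁻¹ * (∏ s, g (a.2 s) (a'.2 s))) * keySign_mul_self ι κ.2 a'.2
      · exact discard_eq_iff.mpr fun p hp => keyedBlocks_off κ a.2 a'.2 hp
      · exact congrArg (·, κ) (discard_eq_iff.mpr fun p hp =>
          congrArg h (keyedBlocks_off κ a.2 a'.2 hp))
    rw [Finset.sum_congr rfl fun κ _ => hterm κ, Finset.sum_const, Finset.card_univ,
      nsmul_eq_mul, ← mul_assoc, mul_inv_cancel₀ (Nat.cast_ne_zero.mpr Fintype.card_ne_zero),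
      one_mul]
  refine exists_protocol (hN.relative_pow (State.maximallyMixed (Fin 2)) b) ?_ ?_ (hN.proper_pow m) hinit henc hdec
    hvalid (fun κ a => ?_) hweight hε
  · intro p p' hp
    exact Prod.ext hp (funext fun _ => rfl)
  · intro p
    exact Finset.prod_eq_one fun i _ => hN.weight_self _
  · refine Prod.ext (funext fun s => ?_) (hfB κ a.2)
    exact (congrArg (fun y => act (κ.1 (ι s).2) (h y))
      (keyedBlocks_on hι h0 h1 κ a.2 s)).trans (hN.act_apply _ _)

/-! ### Asymptotic equivalence -/

/-- Two of sufficiently many blocks may be spent without reducing the rate noticeably. -/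
theorem exists_floor_le_mul_div {δ : ℝ} (hδ : 0 < δ) :
    ∃ j n₀ : ℕ, ∀ n, n₀ ≤ n → ⌊(1 - δ) * n⌋₊ ≤ j * (n / (j + 2)) := by
  obtain ⟨j, hj⟩ := exists_nat_ge (4 / δ)
  obtain ⟨n₀, hn₀⟩ := exists_nat_ge (2 * j / δ)
  refine ⟨j, n₀, fun n hn => Nat.floor_le_of_le ?_⟩
  have hjδ : 4 ≤ j * δ := (div_le_iff₀ hδ).mp hj
  have hnδ : 2 * j ≤ n * δ :=
    ((div_le_iff₀ hδ).mp hn₀).trans (mul_le_mul_of_nonneg_right (by exact_mod_cast hn) hδ.le)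
  have hdiv : (n : ℝ) ≤ (j + 2) * ((n / (j + 2) : ℕ) : ℝ) + (j + 2) := by
    have := Nat.div_add_mod n (j + 2)
    have := Nat.mod_lt n (show 0 < j + 2 by omega)
    exact_mod_cast (by omega : n ≤ (j + 2) * (n / (j + 2)) + (j + 2))
  push_cast
  set q : ℝ := ((n / (j + 2) : ℕ) : ℝ)
  have hj0 : (0 : ℝ) ≤ j := Nat.cast_nonneg j
  have hn0 : (0 : ℝ) ≤ n := Nat.cast_nonneg n
  have h₁ : j * (n : ℝ) ≤ (j + 2) * (j * q + j) := by nlinarith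
  have h₂ : (j + 2) * ((1 - δ) * n + j) ≤ j * (n : ℝ) := by nlinarith
  have h₃ : (j + 2) * ((1 - δ) * n + j) ≤ (j + 2) * (j * q + j) := h₂.trans h₁
  have := le_of_mul_le_mul_left h₃ (by positivity)
  linarith

theorem equivalent_of_isFlipCovariant {C : Type} [Fintype C] [DecidableEq C]
    {N : Channel (Fin 2) (C × Fin 2)} {h : Fin 2 → C} {g : Fin 2 → Fin 2 → ℂ}
    {act : Fin 2 → C → C} (hN : IsFlipCovariant N h g act) :
    (iid (FiniteResource.relative N (State.maximallyMixed (Fin 2)))).Equivalent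
      (iid (FiniteResource.proper N)) := by
  constructor
  · intro δ hδ
    obtain ⟨j, n₀, hj⟩ := exists_floor_le_mul_div hδ
    exact ⟨j + 2, by omega, fun ε hε => ⟨n₀, fun n hn =>
      exists_protocol_proper_of_relative hN (hj n hn) hε.le⟩⟩
  · intro δ hδ
    refine ⟨1, one_pos, fun ε hε => ⟨0, fun n _ => ?_⟩⟩
    have hle : ⌊(1 - δ) * n⌋₊ ≤ n / 1 := by
      rw [Nat.div_one]
      refine Nat.floor_le_of_le ?_
      have : (0 : ℝ) ≤ n := Nat.cast_nonneg n
      nlinarith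
    exact exists_protocol_relative_of_proper hN _ hle hε.le

end

end ResourceTheory

theorem mainTheorem2 :
    ResourceTheory.qubitRel.Equivalent ResourceTheory.qubit ∧
    ResourceTheory.cobitRel.Equivalent ResourceTheory.cobit ∧
    ResourceTheory.cbitRel.Equivalent ResourceTheory.cbit :=
  ⟨ResourceTheory.equivalent_of_isFlipCovariant ResourceTheory.isFlipCovariant_idChannel,
    ResourceTheory.equivalent_of_isFlipCovariant ResourceTheory.isFlipCovariant_coherentChannel,
    ResourceTheory.equivalent_of_isFlipCovariant ResourceTheory.isFlipCovariant_classicalChannel⟩
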